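/- Let $0<q<1$ and let $a,b,c,d$ be complex numbers with $a\neq 0$ and $\max(|a|,|b|,|c|,|d|)<1$ which are real or occur in complex conjugate pairs. Put $(z;q)_k=\prod_{i=0}^{k-1}(1-zq^i)$, $(z_1,\dots,z_r;q)_k=\prod_j(z_j;q)_k$ ($k\le\infty$), and $x(s)=\tfrac12(q^s+q^{-s})$, $\Delta x(s)=x(s+1)-x(s)$ for $s\in\mathbb C$. Let $P_n$ be the monic Askey–Wilson polynomial, $$P_n(x(s))=\frac{(ab,ac,ad;q)_n}{(2a)^n(abcdq^{n-1};q)_n}\;{}_4\varphi_3\!\left(\begin{matrix}q^{-n},\,abcdq^{n-1},\,aq^s,\,aq^{-s}\\ ab,\,ac,\,ad\end{matrix}\,\Big|\,q,q\right),$$ and let $\langle u,f\rangle=\int_{-1}^1 f(x)\rho(x)\,dx$ on $\mathbb C[x]$, where $$\rho(x)=\frac{(q,ab,ac,ad,bc,bd,cd;q)_\infty\,h(x,1)h(x,-1)h(x,q^{1/2})h(x,-q^{1/2})}{2\pi\sqrt{1-x^2}\,(abcd;q)_\infty\,h(x,a)h(x,b)h(x,c)h(x,d)},\qquad h(x,\alpha)=\prod_{k\ge0}(1-2\alpha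 xq^k+\alpha^2q^{2k}).$$ Put $d_n^2=\langle u,P_n^2\rangle$. Let $A,B\ge0$ be real, not both zero, and let $n\ge1$. Then: (i) $d_k^2\ne0$ for all $k\ge0$, and there is exactly one monic polynomial $\widetilde P_n$ of degree $n$ which is orthogonal to all polynomials of degree less than $n$ with respect to $\widetilde u=u+A\delta_{-1}+B\delta_{1}$ (the generalized Askey–Wilson polynomial). With $K_{n-1}(y,z)=\sum_{k=0}^{n-1}P_k(y)P_k(z)/d_k^2$ and $$\kappa_{n-1}=\det\begin{pmatrix}1+AK_{n-1}(-1,-1)&BK_{n-1}(-1,1)\\ AK_{n-1}(1,-1)&1+BK_{n-1}(1,1)\end{pmatrix},$$ one has $\kappa_{n-1}\neq0$ and $$\widetilde P_n(-1)=\frac{(1+BK_{n-1}(1,1))P_n(-1)-BK_{n-1}(-1,1)P_n(1)}{\kappa_{n-1}},\qquad \widetilde P_n(1)=\frac{(1+AK_{n-1}(-1,-1))P_n(1)-AK_{n-1}(1,-1)P_n(-1)}{\kappa_{n-1}}.$$ (ii) For all $s\in\mathbb C$, $$(x(s)^2-1)\,\widetilde P_n(x(s))=A(s,n)P_n(x(s))+B(s,n)P_{n-1}(x(s)),$$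 where $$A(s,n)=x(s)^2-1-\frac1{d_{n-1}^2}\Big\{A\widetilde P_n(-1)P_{n-1}(-1)[x(s)-1]+B\widetilde P_n(1)P_{n-1}(1)[x(s)+1]\Big\},$$ $$B(s,n)=\frac1{d_{n-1}^2}\Big\{A\widetilde P_n(-1)P_n(-1)[x(s)-1]+B\widetilde P_n(1)P_n(1)[x(s)+1]\Big\}$$ are polynomials in $x(s)$ of degree exactly $2$ and $1$, respectively. (iii) Suppose $abcd\,q^{n-2}\ne1$ (a condition only for $n=1$). Then for all $s\in\mathbb C$ with $\Delta x(s)\neq0$, $$P_{n-1}(x(s))=\Theta(s,n)P_n(x(s))+\Xi(s,n)P_n(x(s+1)),$$ and consequently $$(x(s)^2-1)\,\widetilde P_n(x(s))=a(s;n)P_n(x(s))+b(s;n)P_n(x(s+1)),$$ with $a(s;n)=A(s,n)+B(s,n)\Theta(s,n)$ and $b(s;n)=B(s,n)\Xi(s,n)$. Here, with $\varkappa=q^{1/2}-q^{-1/2}$, $$\Phi(s)=-q^{1/2}\varkappa^2q^{2s}(q^{-s}-a)(q^{-s}-b)(q^{-s}-c)(q^{-s}-d),$$ $$\omega_n=\frac{q^{n-1}(1-abcdq^{2n-3})(1-abcdq^{2n-2})^2}{(1-abq^{n-1})(1-acq^{n-1})(1-adq^{n-1})(1-bcq^{n-1})(1-bdq^{n-1})(1-cdq^{n-1})(1-abcdq^{n-2})\,\varkappa\,(1-q^n)},$$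 $$\Xi(s,n)=-\omega_n\frac{\Phi(s)}{\Delta x(s)},$$ $$\begin{aligned}\Theta(s,n)=\omega_n\Big\{&\frac{\Phi(s)}{\Delta x(s)}+2q^{1-n}\varkappa(1-abcdq^{2n-1})\Big[2x(s)-a-a^{-1}+\frac{(1-abcdq^{n-1})(1-abq^n)(1-acq^n)(1-adq^n)}{a(1-abcdq^{2n-1})(1-abcdq^{2n})}\\&+\frac{a(1-q^n)(1-bcq^{n-1})(1-bdq^{n-1})(1-cdq^{n-1})}{(1-abcdq^{2n-2})(1-abcdq^{2n-1})}\Big]\\&-\frac{2q^{1-n/2}\varkappa(1-abcdq^{n-1})}{1-abcdq^{2n}}\Big[2(1-abcdq^{2n})x(s+\tfrac n2)-q^{n/2}\big(a+b+c+d-(abc+abd+acd+bcd)q^n\big)\Big]\\&-4q^{1-n}(1-q^n)(1-abcdq^{n-1})\Delta x(s-\tfrac12)\Big\}.\end{aligned}$$ -/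

import Mathlib

open Polynomial

noncomputable section

namespace AskeyWilson

/-- The finite `q`-shifted factorial `(z; q)_k`. -/
def qPoch (q z : ℂ) (k : ℕ) : ℂ := ∏ i ∈ Finset.range k, (1 - z * q ^ i)

/-- The infinite `q`-shifted factorial `(z; q)_∞`. -/
def qPochInf (q z : ℂ) : ℂ := ∏' i : ℕ, (1 - z * q ^ i)

/-- The basic hypergeometric series `₄φ₃(a₁, a₂, a₃, a₄; b₁, b₂, b₃ | q, z)`. -/
def phi43 (a₁ a₂ a₃ a₄ b₁ b₂ b₃ q z : ℂ) : ℂ :=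
  ∑' k : ℕ, (qPoch q a₁ k * qPoch q a₂ k * qPoch q a₃ k * qPoch q a₄ k) /
    (qPoch q b₁ k * qPoch q b₂ k * qPoch q b₃ k * qPoch q q k) * z ^ k

/-- The base `q` and the four parameters of the Askey-Wilson polynomials. -/
structure Params where
  q : ℝ
  a : ℂ
  b : ℂ
  c : ℂ
  d : ℂ

namespace Params

/-- The standing assumptions: `0 < q < 1`, `max(|a|,|b|,|c|,|d|) < 1`, the parameters are real or
occur in complex conjugate pairs, and `a ≠ 0` (one divides by `a`). -/
structure Admissible (p : Params) : Prop where
  q_pos : 0 < p.q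
  q_lt_one : p.q < 1
  a_ne_zero : p.a ≠ 0
  norm_a : ‖p.a‖ < 1
  norm_b : ‖p.b‖ < 1
  norm_c : ‖p.c‖ < 1
  norm_d : ‖p.d‖ < 1
  conj : Multiset.map (starRingEnd ℂ) {p.a, p.b, p.c, p.d} = ({p.a, p.b, p.c, p.d} : Multiset ℂ)

variable (p : Params)

/-- The base as a complex number. -/
def Q : ℂ := (p.q : ℂ)

/-- The product `abcd`. -/
def abcd : ℂ := p.a * p.b * p.c * p.d

/-- The lattice `x(s) = (q^s + q^{-s}) / 2`. -/
def x (s : ℂ) : ℂ := (p.Q ^ s + p.Q ^ (-s)) / 2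

/-- The forward difference `Δx(s) = x(s + 1) - x(s)`. -/
def dx (s : ℂ) : ℂ := p.x (s + 1) - p.x s

/-- The factor `(ab, ac, ad; q)_n / ((2a)^n (abcd q^{n-1}; q)_n)`. -/
def lead (n : ℕ) : ℂ :=
  (qPoch p.Q (p.a * p.b) n * qPoch p.Q (p.a * p.c) n * qPoch p.Q (p.a * p.d) n) /
    ((2 * p.a) ^ n * qPoch p.Q (p.abcd * p.Q ^ ((n : ℤ) - 1)) n)

/-- The (monic) Askey-Wilson polynomial `P_n`, as a polynomial in `x`. The product over `i < k` is
`(a q^s, a q^{-s}; q)_k` written in terms of `x = x(s)`; see `eval_P`. -/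
def P (n : ℕ) : ℂ[X] :=
  C (p.lead n) * ∑ k ∈ Finset.range (n + 1),
    C ((qPoch p.Q (p.Q ^ (-(n : ℤ))) k * qPoch p.Q (p.abcd * p.Q ^ ((n : ℤ) - 1)) k) /
        (qPoch p.Q (p.a * p.b) k * qPoch p.Q (p.a * p.c) k * qPoch p.Q (p.a * p.d) k *
          qPoch p.Q p.Q k) * p.Q ^ k) *
      ∏ i ∈ Finset.range k, (1 - C (2 * p.a * p.Q ^ i) * X + C (p.a ^ 2 * p.Q ^ (2 * i)))

theorem qPoch_mul_qPoch (hq : 0 < p.q) (s : ℂ) (k : ℕ) :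
    qPoch p.Q (p.a * p.Q ^ s) k * qPoch p.Q (p.a * p.Q ^ (-s)) k =
      ∏ i ∈ Finset.range k, (1 - 2 * p.a * p.Q ^ i * p.x s + p.a ^ 2 * p.Q ^ (2 * i)) := by
  have hQ : p.Q ≠ 0 := by simpa [Q] using hq.ne'
  have h : p.Q ^ s * p.Q ^ (-s) = 1 := by
    rw [← Complex.cpow_add _ _ hQ]; simp
  unfold qPoch x
  rw [← Finset.prod_mul_distrib]
  refine Finset.prod_congr rfl fun i _ => ?_
  linear_combination (p.a ^ 2 * p.Q ^ (2 * i)) * h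

theorem qPoch_neg_eq_zero (hq : 0 < p.q) {n k : ℕ} (h : n < k) :
    qPoch p.Q (p.Q ^ (-(n : ℤ))) k = 0 := by
  have hQ : p.Q ≠ 0 := by simpa [Q] using hq.ne'
  refine Finset.prod_eq_zero (Finset.mem_range.2 h) ?_
  simp [hQ]

/-- On the lattice, `P_n` is the classical `₄φ₃` expression. -/
theorem eval_P (hq : 0 < p.q) (n : ℕ) (s : ℂ) :
    (p.P n).eval (p.x s) = p.lead n *
      phi43 (p.Q ^ (-(n : ℤ))) (p.abcd * p.Q ^ ((n : ℤ) - 1)) (p.a * p.Q ^ s) (p.a * p.Q ^ (-s))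
        (p.a * p.b) (p.a * p.c) (p.a * p.d) p.Q p.Q := by
  unfold P phi43
  rw [tsum_eq_sum (s := Finset.range (n + 1))]
  · simp only [eval_mul, eval_C, eval_finsetSum, eval_prod, eval_add, eval_sub, eval_one, eval_X]
    congr 1
    refine Finset.sum_congr rfl fun k _ => ?_
    rw [← p.qPoch_mul_qPoch hq s k]
    ring
  · intro k hk
    rw [p.qPoch_neg_eq_zero hq (by simpa using hk)]
    simp

/-- `h(x, α) = ∏_{k ≥ 0} (1 - 2 α x q^k + α² q^{2k})`. -/
def h (t α : ℂ) : ℂ := ∏' k : ℕ, (1 - 2 * α * t * p.Q ^ k + α ^ 2 * p.Q ^ (2 * k))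

/-- The Askey-Wilson weight on `(-1, 1)`, normalised to total mass one. -/
def rho (t : ℝ) : ℂ :=
  (qPochInf p.Q p.Q * qPochInf p.Q (p.a * p.b) * qPochInf p.Q (p.a * p.c) *
      qPochInf p.Q (p.a * p.d) * qPochInf p.Q (p.b * p.c) * qPochInf p.Q (p.b * p.d) *
      qPochInf p.Q (p.c * p.d) *
      (p.h t 1 * p.h t (-1) * p.h t (Real.sqrt p.q : ℂ) * p.h t (-(Real.sqrt p.q : ℂ)))) /
    (2 * (Real.pi : ℂ) * (Real.sqrt (1 - t ^ 2) : ℂ) * qPochInf p.Q p.abcd *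
      (p.h t p.a * p.h t p.b * p.h t p.c * p.h t p.d))

/-- The functional `⟨u, f⟩ = ∫_{-1}^{1} f(x) ρ(x) dx`. -/
def u (f : ℂ[X]) : ℂ := ∫ t in (-1 : ℝ)..1, f.eval (t : ℂ) * p.rho t

/-- The modified functional `u + A δ_{-1} + B δ_{1}`. -/
def uMod (A B : ℝ) (f : ℂ[X]) : ℂ := p.u f + A * f.eval (-1) + B * f.eval 1

/-- `d_n² = ⟨u, P_n²⟩`. -/
def dSq (n : ℕ) : ℂ := p.u (p.P n ^ 2)

/-- The sum `∑_{k < n} P_k(y) P_k(z) / d_k²`, that is, the reproducing kernel `K_{n-1}(y, z)`. -/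
def kerPred (n : ℕ) (y z : ℂ) : ℂ :=
  ∑ k ∈ Finset.range n, (p.P k).eval y * (p.P k).eval z / p.dSq k

end Params

/-- `f` is the monic orthogonal polynomial of degree `n` of the functional `L`. -/
structure IsMonicOP (L : ℂ[X] → ℂ) (n : ℕ) (f : ℂ[X]) : Prop where
  monic : f.Monic
  natDegree_eq : f.natDegree = n
  orthogonal : ∀ g : ℂ[X], g.degree < n → L (f * g) = 0

namespace Params

variable (p : Params)

/-- `f` is the generalized Askey-Wilson polynomial `P̃_n` with masses `A` at `-1` and `B` at `1`. -/
def IsGenAW (A B : ℝ) (n : ℕ) (f : ℂ[X]) : Prop := IsMonicOP (p.uMod A B) n f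

/-- The determinant `κ_{n-1}(-1, 1)`. -/
def kappa (A B : ℝ) (n : ℕ) : ℂ :=
  !![1 + A * p.kerPred n (-1) (-1), B * p.kerPred n (-1) 1;
     A * p.kerPred n 1 (-1), 1 + B * p.kerPred n 1 1].det

/-- The polynomial `A(s, n)` in `x(s)`; `f` stands for `P̃_n`. -/
def coeffA (A B : ℝ) (n : ℕ) (f : ℂ[X]) : ℂ[X] :=
  (X ^ 2 - 1) - C (1 / p.dSq (n - 1)) *
    (C (A * f.eval (-1) * (p.P (n - 1)).eval (-1)) * (X - 1) +
      C (B * f.eval 1 * (p.P (n - 1)).eval 1) * (X + 1))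

/-- The polynomial `B(s, n)` in `x(s)`; `f` stands for `P̃_n`. -/
def coeffB (A B : ℝ) (n : ℕ) (f : ℂ[X]) : ℂ[X] :=
  C (1 / p.dSq (n - 1)) *
    (C (A * f.eval (-1) * (p.P n).eval (-1)) * (X - 1) +
      C (B * f.eval 1 * (p.P n).eval 1) * (X + 1))

/-- `ϰ = q^{1/2} - q^{-1/2}`. -/
def vk : ℂ := p.Q ^ (1 / 2 : ℂ) - p.Q ^ (-(1 / 2) : ℂ)

/-- `Φ(s) = -q^{1/2} (q^{1/2} - q^{-1/2})² q^{2s} (q^{-s} - a)(q^{-s} - b)(q^{-s} - c)(q^{-s} - d)`. -/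
def Phi (s : ℂ) : ℂ :=
  -p.Q ^ (1 / 2 : ℂ) * p.vk ^ 2 * p.Q ^ (2 * s) *
    ((p.Q ^ (-s) - p.a) * (p.Q ^ (-s) - p.b) * (p.Q ^ (-s) - p.c) * (p.Q ^ (-s) - p.d))

/-- The common factor of `Θ(s, n)` and `-Ξ(s, n)`. -/
def pre (n : ℕ) : ℂ :=
  p.Q ^ ((n : ℤ) - 1) * (1 - p.abcd * p.Q ^ (2 * (n : ℤ) - 3)) *
      (1 - p.abcd * p.Q ^ (2 * (n : ℤ) - 2)) ^ 2 /
    ((1 - p.a * p.b * p.Q ^ ((n : ℤ) - 1)) * (1 - p.a * p.c * p.Q ^ ((n : ℤ) - 1)) *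
      (1 - p.a * p.d * p.Q ^ ((n : ℤ) - 1)) * (1 - p.b * p.c * p.Q ^ ((n : ℤ) - 1)) *
      (1 - p.b * p.d * p.Q ^ ((n : ℤ) - 1)) * (1 - p.c * p.d * p.Q ^ ((n : ℤ) - 1)) *
      (1 - p.abcd * p.Q ^ ((n : ℤ) - 2)) * p.vk * (1 - p.Q ^ n))

/-- The coefficient `Ξ(s, n)`. -/
def Xi (s : ℂ) (n : ℕ) : ℂ := -(p.pre n * (p.Phi s / p.dx s))

/-- The coefficient `Θ(s, n)`. -/
def Theta (s : ℂ) (n : ℕ) : ℂ :=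
  p.pre n *
    (p.Phi s / p.dx s
      + 2 * p.Q ^ (1 - (n : ℤ)) * p.vk * (1 - p.abcd * p.Q ^ (2 * (n : ℤ) - 1)) *
        (2 * p.x s - p.a - p.a⁻¹
          + (1 - p.abcd * p.Q ^ ((n : ℤ) - 1)) *
            ((1 - p.a * p.b * p.Q ^ n) * (1 - p.a * p.c * p.Q ^ n) * (1 - p.a * p.d * p.Q ^ n)) /
            (p.a * (1 - p.abcd * p.Q ^ (2 * (n : ℤ) - 1)) * (1 - p.abcd * p.Q ^ (2 * n)))
          + p.a * (1 - p.Q ^ n) *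
            ((1 - p.b * p.c * p.Q ^ ((n : ℤ) - 1)) * (1 - p.b * p.d * p.Q ^ ((n : ℤ) - 1)) *
              (1 - p.c * p.d * p.Q ^ ((n : ℤ) - 1))) /
            ((1 - p.abcd * p.Q ^ (2 * (n : ℤ) - 2)) * (1 - p.abcd * p.Q ^ (2 * (n : ℤ) - 1))))
      - 2 * p.Q ^ (1 - (n : ℂ) / 2) * p.vk * (1 - p.abcd * p.Q ^ ((n : ℤ) - 1)) /
          (1 - p.abcd * p.Q ^ (2 * n)) *
        (2 * (1 - p.abcd * p.Q ^ (2 * n)) * p.x (s + (n : ℂ) / 2)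
          - p.Q ^ ((n : ℂ) / 2) *
            (p.a + p.b + p.c + p.d
              - (p.a * p.b * p.c + p.a * p.b * p.d + p.a * p.c * p.d + p.b * p.c * p.d) * p.Q ^ n))
      - 4 * p.Q ^ (1 - (n : ℤ)) * (1 - p.Q ^ n) * (1 - p.abcd * p.Q ^ ((n : ℤ) - 1)) *
        p.dx (s - 1 / 2))

end Params

end AskeyWilson

end

/-! Orthogonality. With x = (z + 1/z)/2 and |z| = 1 the weight is a constant times N(z)N(1/z), where
N is `halfWeight`, and N(z)A(z) = N(qz) for the coefficient A (`awCoeff`) of the Askey-Wilson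
operator. Pairing the image of f with g therefore leads to the integral of N(qz)N(1/z)f(qz)g(z).
Moving the contour from |z| = 1 to |z| = 1/q and inverting exchanges f and g
(`shift_integral_symm`), so the operator is symmetric for u. It is bidiagonal in the basis (az, a/z;
q)_k, which makes each P_n an eigenfunction (`isEigen_P`); distinct eigenvalues give orthogonality.

Positivity. Since the parameters are closed under conjugation, the weight is positive. This yields
d_n² > 0, real coefficients of P_n, and P_n(±1) ≠ 0.

Point masses. Expanding P̃_n - P_n in P_0, …, P_{n-1} expresses P̃_n through P_n, the kernels at ±1
and the values P̃_n(±1) (`IsGenAW.eq_sub`). Evaluation at ±1 is a 2×2 linear system with determinant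
κ_{n-1}, and Cauchy-Schwarz gives κ_{n-1} ≥ 1. Multiplying by x² - 1 and applying
`christoffel_darboux` at ±1 gives the connection formula. The exact degree of B(s, n) comes from the
positivity of a quadratic form.

Lowering. Θ P_n(x(s)) + Ξ P_n(x(s+1)) equals (Θ + Ξ) P_n(x(s)) plus Ξ times the difference of P_n.
Expanded in the same basis, its discrepancy from P_{n-1} telescopes to a vanishing boundary term
(`sum_lowering`, `eval_P_pred`). -/

namespace AskeyWilson

/-! ### Infinite q-shifted factorials: analyticity, zeros, conjugation, positivity. -/

theorem summable_norm_qPoch {q : ℂ} (hq : ‖q‖ < 1) (z : ℂ) :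
    Summable fun i : ℕ => ‖-(z * q ^ i)‖ := by
  simpa [norm_mul, norm_pow] using
    (summable_geometric_of_lt_one (norm_nonneg q) hq).mul_left ‖z‖

theorem multipliable_qPoch {q : ℂ} (hq : ‖q‖ < 1) (z : ℂ) :
    Multipliable fun i : ℕ => 1 - z * q ^ i := by
  simpa [sub_eq_add_neg] using multipliable_one_add_of_summable (summable_norm_qPoch hq z)

theorem qPochInf_eq_mul {q : ℂ} (hq : ‖q‖ < 1) (z : ℂ) :
    qPochInf q z = (1 - z) * qPochInf q (z * q) := by
  unfold qPochInf
  have h : Multipliable fun i : ℕ => 1 - z * q ^ (i + 1) := by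
    simpa [pow_succ', mul_assoc] using multipliable_qPoch hq (z * q)
  have h2 := tprod_eq_zero_mul' (f := fun i : ℕ => 1 - z * q ^ i) h
  simp only [pow_zero, mul_one] at h2
  rw [h2]
  congr 2 with i
  ring

theorem qPochInf_one {q : ℂ} (hq : ‖q‖ < 1) : qPochInf q 1 = 0 := by
  rw [qPochInf_eq_mul hq]; simp

theorem qPochInf_ne_zero {q z : ℂ} (hq : ‖q‖ < 1) (hz : ‖z‖ < 1) : qPochInf q z ≠ 0 := by
  unfold qPochInf
  simp_rw [sub_eq_add_neg]
  refine tprod_one_add_ne_zero_of_summable (fun i h => ?_) (summable_norm_qPoch hq z)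
  have h1 : z * q ^ i = 1 := by linear_combination -h
  have h2 : ‖z * q ^ i‖ < 1 := by
    rw [norm_mul, norm_pow]
    exact mul_lt_one_of_nonneg_of_lt_one_left (norm_nonneg _) hz (pow_le_one₀ (norm_nonneg _) hq.le)
  rw [h1] at h2
  simp at h2

theorem differentiable_qPochInf {q : ℂ} (hq : ‖q‖ < 1) : Differentiable ℂ (qPochInf q) := by
  intro z
  have hU : IsOpen (Metric.ball (0 : ℂ) (‖z‖ + 1)) := Metric.isOpen_ball
  have hs : Summable fun i : ℕ => (‖z‖ + 1) * ‖q‖ ^ i :=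
    (summable_geometric_of_lt_one (norm_nonneg q) hq).mul_left _
  have hp : HasProdLocallyUniformlyOn (fun (i : ℕ) (w : ℂ) => 1 + -(w * q ^ i))
      (fun w => ∏' i : ℕ, (1 + -(w * q ^ i))) (Metric.ball (0 : ℂ) (‖z‖ + 1)) := by
    refine hs.hasProdLocallyUniformlyOn_nat_one_add hU (.of_forall fun i w hw => ?_)
      fun i => by fun_prop
    rw [norm_neg, norm_mul, norm_pow]
    have : ‖w‖ ≤ ‖z‖ + 1 := by simpa using (Metric.mem_ball.1 hw).le
    gcongr
  have hd := hp.differentiableOn (.of_forall fun s => by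
    simpa [Finset.prod_fn] using DifferentiableOn.finsetProd (fun _ _ => by fun_prop)) hU
  have := hd.differentiableAt (hU.mem_nhds (x := z) (by simp))
  have heq : qPochInf q = fun w => ∏' i : ℕ, (1 + -(w * q ^ i)) := by
    ext w
    simp only [qPochInf, sub_eq_add_neg]
  rw [heq]
  exact this

theorem conj_qPochInf {q : ℂ} (hq : ‖q‖ < 1) (z : ℂ) :
    starRingEnd ℂ (qPochInf q z) = qPochInf (starRingEnd ℂ q) (starRingEnd ℂ z) := by
  unfold qPochInf
  rw [(multipliable_qPoch hq z).map_tprod (starRingEnd ℂ) Complex.continuous_conj]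
  simp

open scoped ComplexOrder in
/-- `(z; q)_∞` is positive for real `z` with `|z| < 1`. -/
theorem qPochInf_pos {q : ℝ} (hq0 : 0 ≤ q) (hq : q < 1) {z : ℂ} (hz : ‖z‖ < 1)
    (hz' : starRingEnd ℂ z = z) : 0 < qPochInf q z := by
  have hq' : ‖(q : ℂ)‖ < 1 := by simpa [abs_of_nonneg hq0] using hq
  obtain ⟨x, rfl⟩ := Complex.conj_eq_iff_real.1 hz'
  have hx : |x| < 1 := by simpa using hz
  -- The product is nonzero, so it is enough that it is a limit of nonnegative partial products.
  refine lt_of_le_of_ne ?_ (qPochInf_ne_zero hq' hz).symm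
  have h := (multipliable_qPoch hq' x).hasProd
  refine ge_of_tendsto' h fun s => ?_
  refine Finset.prod_nonneg fun i _ => ?_
  have h1 : x * q ^ i ≤ 1 := by
    have := abs_lt.1 hx
    have h2 : q ^ i ≤ 1 := pow_le_one₀ hq0 hq.le
    have h3 : 0 ≤ q ^ i := pow_nonneg hq0 i
    nlinarith
  have : (0 : ℂ) ≤ ((1 - x * q ^ i : ℝ) : ℂ) := by exact_mod_cast sub_nonneg.2 h1
  simpa using this

open scoped ComplexOrder in
-- Nonreal members cancel in conjugate pairs, each pair contributing |G z|². The induction is strong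
-- because one step may remove two members.
theorem prod_map_pos_of_conj_closed (G : ℂ → ℂ)
    (hG : ∀ z, G (starRingEnd ℂ z) = starRingEnd ℂ (G z)) (n : ℕ) :
    ∀ s : Multiset ℂ, s.card = n → s.map (starRingEnd ℂ) = s → (∀ z ∈ s, G z ≠ 0) →
      (∀ z ∈ s, starRingEnd ℂ z = z → 0 < G z) → 0 < (s.map G).prod := by
  induction n using Nat.strong_induction_on with
  | _ n ih =>
    intro s hn hs hne hpos
    induction s using Multiset.induction_on with
    | empty => simp
    | cons x t _ =>
      have hx : x ∈ x ::ₘ t := Multiset.mem_cons_self x t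
      by_cases hr : starRingEnd ℂ x = x
      · rw [Multiset.map_cons, hr, Multiset.cons_inj_right] at hs
        rw [Multiset.map_cons, Multiset.prod_cons]
        refine mul_pos (hpos x hx hr) (ih t.card (by simp [← hn]) t rfl hs
          (fun z hz => hne z (Multiset.mem_cons_of_mem hz))
          fun z hz => hpos z (Multiset.mem_cons_of_mem hz))
      · have hm : starRingEnd ℂ x ∈ x ::ₘ t := by
          rw [← hs]; exact Multiset.mem_map_of_mem _ hx
        have hm' : starRingEnd ℂ x ∈ t := (Multiset.mem_cons.1 hm).resolve_left hr
        obtain ⟨v, rfl⟩ := Multiset.exists_cons_of_mem hm'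
        rw [Multiset.map_cons, Multiset.map_cons, Complex.conj_conj, Multiset.cons_swap,
          Multiset.cons_inj_right, Multiset.cons_inj_right] at hs
        rw [Multiset.map_cons, Multiset.map_cons, Multiset.prod_cons, Multiset.prod_cons, hG,
          ← mul_assoc, Complex.mul_conj]
        refine mul_pos ?_ (ih v.card (by simp [← hn]) v rfl hs
          (fun z hz => hne z (Multiset.mem_cons_of_mem (Multiset.mem_cons_of_mem hz)))
          fun z hz => hpos z (Multiset.mem_cons_of_mem (Multiset.mem_cons_of_mem hz)))
        exact_mod_cast Complex.normSq_pos.2 (hne x hx)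

/-- For k = 2 these are the products ab, …, cd in the constant of the weight; they need not be real
individually, only closed under conjugation together. -/
theorem pairProducts_conj_closed {s : Multiset ℂ} (hs : s.map (starRingEnd ℂ) = s) (k : ℕ) :
    ((s.powersetCard k).map Multiset.prod).map (starRingEnd ℂ) =
      (s.powersetCard k).map Multiset.prod := by
  conv_rhs => rw [← hs, Multiset.powersetCard_map]
  simp [Multiset.map_map, map_multiset_prod]

theorem prod_map_powersetCard_two (G : ℂ → ℂ) (a b c d : ℂ) :
    (((({a, b, c, d} : Multiset ℂ).powersetCard 2).map Multiset.prod).map G).prod =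
      G (a * b) * G (a * c) * G (a * d) * G (b * c) * G (b * d) * G (c * d) := by
  have h2 : (2 : ℕ) = 0 + 1 + 1 := rfl
  simp only [Multiset.insert_eq_cons, ← Multiset.cons_zero, h2, Multiset.powersetCard_cons,
    Multiset.powersetCard_zero_left, Multiset.powersetCard_zero_right]
  simp
  ring

theorem tprod_qPoch_mul {q : ℂ} (hq : ‖q‖ < 1) (z w : ℂ) :
    ∏' k : ℕ, ((1 - z * q ^ k) * (1 - w * q ^ k)) = qPochInf q z * qPochInf q w :=
  (multipliable_qPoch hq z).tprod_mul (multipliable_qPoch hq w)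

/-! ### The Askey-Wilson weight as N(z)N(1/z) on the unit circle. -/

namespace Params

variable {p : Params}

namespace Admissible

theorem norm_Q_lt (hp : p.Admissible) : ‖p.Q‖ < 1 := by
  simpa [Q, abs_of_pos hp.q_pos] using hp.q_lt_one

theorem Q_ne_zero (hp : p.Admissible) : p.Q ≠ 0 := by simpa [Q] using hp.q_pos.ne'

theorem conj_Q : starRingEnd ℂ p.Q = p.Q := by simp [Q]

theorem norm_mem (hp : p.Admissible) {z : ℂ} (hz : z ∈ ({p.a, p.b, p.c, p.d} : Multiset ℂ)) :
    ‖z‖ < 1 := by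
  simp only [Multiset.insert_eq_cons, Multiset.mem_cons, Multiset.mem_singleton] at hz
  obtain rfl | rfl | rfl | rfl := hz
  exacts [hp.norm_a, hp.norm_b, hp.norm_c, hp.norm_d]

theorem norm_abcd_lt (hp : p.Admissible) : ‖p.abcd‖ < 1 := by
  rw [abcd, norm_mul, norm_mul, norm_mul]
  exact mul_lt_one_of_nonneg_of_lt_one_left (by positivity) (mul_lt_one_of_nonneg_of_lt_one_left
    (by positivity) (mul_lt_one_of_nonneg_of_lt_one_left (by positivity) hp.norm_a hp.norm_b.le)
    hp.norm_c.le) hp.norm_d.le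

theorem norm_mul_lt {z w : ℂ} (hz : ‖z‖ < 1) (hw : ‖w‖ < 1) : ‖z * w‖ < 1 := by
  rw [norm_mul]
  exact mul_lt_one_of_nonneg_of_lt_one_left (norm_nonneg _) hz hw.le

theorem conj_abcd (hp : p.Admissible) : starRingEnd ℂ p.abcd = p.abcd := by
  have h : (({p.a, p.b, p.c, p.d} : Multiset ℂ)).prod = p.abcd := by
    simp [abcd, mul_assoc]
  rw [← h, map_multiset_prod, hp.conj]

end Admissible

variable (p)

/-- The constant factor of the weight. -/
noncomputable def massConst : ℂ :=
  (qPochInf p.Q p.Q * qPochInf p.Q (p.a * p.b) * qPochInf p.Q (p.a * p.c) *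
      qPochInf p.Q (p.a * p.d) * qPochInf p.Q (p.b * p.c) * qPochInf p.Q (p.b * p.d) *
      qPochInf p.Q (p.c * p.d)) / (2 * (Real.pi : ℂ) * qPochInf p.Q p.abcd)

/-- The half weight `N` with `w(z) = N(z) N(1/z)`. -/
noncomputable def halfWeight (z : ℂ) : ℂ :=
  (qPochInf p.Q z * qPochInf p.Q (-z) * qPochInf p.Q ((Real.sqrt p.q : ℂ) * z) *
      qPochInf p.Q (-(Real.sqrt p.q : ℂ) * z)) /
    (qPochInf p.Q (p.a * z) * qPochInf p.Q (p.b * z) * qPochInf p.Q (p.c * z) *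
      qPochInf p.Q (p.d * z))

variable {p}

open scoped ComplexOrder in
theorem massConst_pos (hp : p.Admissible) : 0 < p.massConst := by
  have hE : ∀ z, qPochInf p.Q (starRingEnd ℂ z) = starRingEnd ℂ (qPochInf p.Q z) := fun z => by
    rw [conj_qPochInf hp.norm_Q_lt, Admissible.conj_Q]
  have h1 : 0 < qPochInf p.Q p.Q :=
    qPochInf_pos hp.q_pos.le hp.q_lt_one hp.norm_Q_lt Admissible.conj_Q
  have h2 : 0 < qPochInf p.Q p.abcd :=
    qPochInf_pos hp.q_pos.le hp.q_lt_one hp.norm_abcd_lt hp.conj_abcd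
  have hn : ∀ z ∈ (({p.a, p.b, p.c, p.d} : Multiset ℂ).powersetCard 2).map Multiset.prod,
      ‖z‖ < 1 := by
    intro z hz
    obtain ⟨m, hm, rfl⟩ := Multiset.mem_map.1 hz
    obtain ⟨hm1, hm2⟩ := Multiset.mem_powersetCard.1 hm
    obtain ⟨x, y, rfl⟩ := Multiset.card_eq_two.1 hm2
    have hx := hp.norm_mem (Multiset.mem_of_le hm1 (by simp : x ∈ ({x, y} : Multiset ℂ)))
    have hy := hp.norm_mem (Multiset.mem_of_le hm1 (by simp : y ∈ ({x, y} : Multiset ℂ)))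
    simpa using Admissible.norm_mul_lt hx hy
  have h3 := prod_map_pos_of_conj_closed (qPochInf p.Q) hE _ _ rfl
    (pairProducts_conj_closed hp.conj 2) (fun z hz => qPochInf_ne_zero hp.norm_Q_lt (hn z hz))
    fun z hz hz' => qPochInf_pos hp.q_pos.le hp.q_lt_one (hn z hz) hz'
  rw [prod_map_powersetCard_two] at h3
  have h4 : (0 : ℂ) < (Real.pi : ℂ) := by exact_mod_cast Real.pi_pos
  have h5 := mul_pos h1 h3
  have h6 : 0 < 2 * (Real.pi : ℂ) * qPochInf p.Q p.abcd := by positivity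
  have h7 := div_pos h5 h6
  convert h7 using 1
  unfold massConst
  ring

theorem h_eq (hp : p.Admissible) {z w : ℂ} (hzw : z * w = 1) (α : ℂ) :
    p.h ((z + w) / 2) α = qPochInf p.Q (α * z) * qPochInf p.Q (α * w) := by
  rw [← tprod_qPoch_mul hp.norm_Q_lt]
  unfold h
  congr 1
  funext k
  linear_combination (-(α ^ 2 * p.Q ^ (2 * k))) * hzw

/-- The Jacobian sin θ of x = cos θ cancels √(1 - x²), and each h(x, α) splits into (αz; q)_∞ (α/z;
q)_∞ by `h_eq`. -/
theorem sin_mul_rho_cos (hp : p.Admissible) {θ : ℝ} (h0 : 0 < θ) (h1 : θ < Real.pi) :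
    (Real.sin θ : ℂ) * p.rho (Real.cos θ) =
      p.massConst * (p.halfWeight (Complex.exp (θ * Complex.I)) *
        p.halfWeight (Complex.exp (-(θ * Complex.I)))) := by
  have hs : 0 < Real.sin θ := Real.sin_pos_of_pos_of_lt_pi h0 h1
  have hsq : Real.sqrt (1 - Real.cos θ ^ 2) = Real.sin θ := by
    rw [← Real.sin_sq, Real.sqrt_sq hs.le]
  have hzw : Complex.exp (θ * Complex.I) * Complex.exp (-(θ * Complex.I)) = 1 := by
    rw [← Complex.exp_add]; simp
  have hc : (Real.cos θ : ℂ) =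
      (Complex.exp (θ * Complex.I) + Complex.exp (-(θ * Complex.I))) / 2 := by
    rw [Complex.ofReal_cos, Complex.cos, neg_mul]
  have hs' : (Real.sin θ : ℂ) ≠ 0 := by exact_mod_cast hs.ne'
  unfold rho massConst halfWeight
  rw [hsq, hc]
  simp only [h_eq hp hzw, one_mul, neg_mul]
  generalize Complex.exp (θ * Complex.I) = z
  generalize Complex.exp (-(θ * Complex.I)) = w
  generalize (Real.sin θ : ℂ) = σ at *
  generalize (Real.pi : ℂ) = ϖ
  generalize qPochInf p.Q = E
  rw [div_mul_div_comm, div_mul_div_comm, ← mul_div_assoc]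
  conv_rhs => rw [← mul_div_mul_left _ _ hs']
  congr 1 <;> ring

theorem conj_halfWeight (hp : p.Admissible) (z : ℂ) :
    starRingEnd ℂ (p.halfWeight z) = p.halfWeight (starRingEnd ℂ z) := by
  have hE : ∀ z, starRingEnd ℂ (qPochInf p.Q z) = qPochInf p.Q (starRingEnd ℂ z) := fun z => by
    rw [conj_qPochInf hp.norm_Q_lt, Admissible.conj_Q]
  have h1 : ∀ w, (({p.a, p.b, p.c, p.d} : Multiset ℂ).map fun e => qPochInf p.Q (e * w)).prod =
      qPochInf p.Q (p.a * w) * qPochInf p.Q (p.b * w) * qPochInf p.Q (p.c * w) *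
        qPochInf p.Q (p.d * w) := by
    intro w; simp [mul_assoc]
  unfold halfWeight
  rw [map_div₀, ← h1, ← h1, map_multiset_prod, Multiset.map_map]
  conv_rhs => rw [← hp.conj, Multiset.map_map]
  simp [hE]

theorem qPochInf_mul_ne_zero (hp : p.Admissible) {e z : ℂ} (he : ‖e‖ < 1) (hz : ‖z‖ ≤ 1) :
    qPochInf p.Q (e * z) ≠ 0 := by
  refine qPochInf_ne_zero hp.norm_Q_lt ?_
  rw [norm_mul]
  exact mul_lt_one_of_nonneg_of_lt_one_left (norm_nonneg _) he hz

theorem norm_sqrt_lt (hp : p.Admissible) : ‖(Real.sqrt p.q : ℂ)‖ < 1 := by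
  rw [Complex.norm_real, Real.norm_of_nonneg (Real.sqrt_nonneg _), Real.sqrt_lt' one_pos]
  simpa using hp.q_lt_one

theorem halfWeight_ne_zero (hp : p.Admissible) {z : ℂ} (hz : ‖z‖ ≤ 1) (h1 : z ≠ 1)
    (h2 : z ≠ -1) : p.halfWeight z ≠ 0 := by
  have hQ := hp.norm_Q_lt
  have hr := norm_sqrt_lt hp
  have hr' : ‖-(Real.sqrt p.q : ℂ)‖ < 1 := by rwa [norm_neg]
  have e1 : qPochInf p.Q z ≠ 0 := by
    rw [qPochInf_eq_mul hQ, mul_comm z]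
    exact mul_ne_zero (sub_ne_zero.2 h1.symm) (qPochInf_mul_ne_zero hp hQ hz)
  have e2 : qPochInf p.Q (-z) ≠ 0 := by
    rw [qPochInf_eq_mul hQ, mul_comm (-z)]
    refine mul_ne_zero (fun h => h2 (by linear_combination h))
      (qPochInf_mul_ne_zero hp hQ (by rwa [norm_neg]))
  unfold halfWeight
  refine div_ne_zero (mul_ne_zero (mul_ne_zero (mul_ne_zero e1 e2)
    (qPochInf_mul_ne_zero hp hr hz)) (qPochInf_mul_ne_zero hp hr' hz)) ?_
  exact mul_ne_zero (mul_ne_zero (mul_ne_zero (qPochInf_mul_ne_zero hp hp.norm_a hz)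
    (qPochInf_mul_ne_zero hp hp.norm_b hz)) (qPochInf_mul_ne_zero hp hp.norm_c hz))
    (qPochInf_mul_ne_zero hp hp.norm_d hz)

theorem differentiableAt_halfWeight (hp : p.Admissible) {z : ℂ} (hz : ‖z‖ ≤ 1) :
    DifferentiableAt ℂ p.halfWeight z := by
  have hE := differentiable_qPochInf hp.norm_Q_lt
  have hE' : ∀ e : ℂ, DifferentiableAt ℂ (fun z => qPochInf p.Q (e * z)) z := fun e =>
    (hE (e * z)).comp z (by fun_prop)
  have hn : DifferentiableAt ℂ (fun z => qPochInf p.Q (-z)) z :=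
    (hE (-z)).comp z (by fun_prop)
  unfold halfWeight
  refine DifferentiableAt.div ((((hE z).mul hn).mul (hE' _)).mul (hE' _))
    ((((hE' _).mul (hE' _)).mul (hE' _)).mul (hE' _)) ?_
  exact mul_ne_zero (mul_ne_zero (mul_ne_zero (qPochInf_mul_ne_zero hp hp.norm_a hz)
    (qPochInf_mul_ne_zero hp hp.norm_b hz)) (qPochInf_mul_ne_zero hp hp.norm_c hz))
    (qPochInf_mul_ne_zero hp hp.norm_d hz)

/-- The zeros of N at ±1 make both sides of the pointwise identity in `IsEigen.integral_eq` vanish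
where `awCoeff` has a pole. -/
theorem halfWeight_one (hp : p.Admissible) : p.halfWeight 1 = 0 := by
  simp [halfWeight, qPochInf_one hp.norm_Q_lt]

theorem halfWeight_neg_one (hp : p.Admissible) : p.halfWeight (-1) = 0 := by
  simp [halfWeight, qPochInf_one hp.norm_Q_lt]

/-- The functional equation `N(z) ∏ (1 - e z) = N(q z) (1 - z²)(1 - q z²)`. -/
theorem halfWeight_mul (hp : p.Admissible) {z : ℂ} (hz : ‖z‖ ≤ 1) :
    p.halfWeight z * ((1 - p.a * z) * (1 - p.b * z) * (1 - p.c * z) * (1 - p.d * z)) =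
      p.halfWeight (p.Q * z) * ((1 - z ^ 2) * (1 - p.Q * z ^ 2)) := by
  have hQ := hp.norm_Q_lt
  have hs : (Real.sqrt p.q : ℂ) ^ 2 = p.Q := by
    rw [Q, ← Complex.ofReal_pow, Real.sq_sqrt hp.q_pos.le]
  have key : ∀ e w : ℂ, w = e * z → qPochInf p.Q w = (1 - e * z) * qPochInf p.Q (e * (p.Q * z)) :=
    fun e w h => by
      rw [h, qPochInf_eq_mul hQ]
      congr 2
      ring
  have hd : ∀ e : ℂ, ‖e‖ < 1 → (1 - e * z) ≠ 0 ∧ qPochInf p.Q (e * (p.Q * z)) ≠ 0 := fun e he => by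
    have := qPochInf_mul_ne_zero hp he hz
    rw [key e _ rfl] at this
    exact ⟨left_ne_zero_of_mul this, right_ne_zero_of_mul this⟩
  obtain ⟨a1, a2⟩ := hd _ hp.norm_a
  obtain ⟨b1, b2⟩ := hd _ hp.norm_b
  obtain ⟨c1, c2⟩ := hd _ hp.norm_c
  obtain ⟨d1, d2⟩ := hd _ hp.norm_d
  unfold halfWeight
  -- One factor 1 - ez is split off each product. Those with e = ±1, ±√q multiply to (1 - z²)(1 -
  -- qz²).
  rw [key 1 z (by ring), key (-1) (-z) (by ring), key (Real.sqrt p.q : ℂ) _ rfl,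
    key (-(Real.sqrt p.q : ℂ)) _ rfl, key p.a _ rfl, key p.b _ rfl, key p.c _ rfl, key p.d _ rfl]
  simp only [one_mul, neg_one_mul]
  generalize qPochInf p.Q (p.a * (p.Q * z)) = ea at *
  generalize qPochInf p.Q (p.b * (p.Q * z)) = eb at *
  generalize qPochInf p.Q (p.c * (p.Q * z)) = ec at *
  generalize qPochInf p.Q (p.d * (p.Q * z)) = ed at *
  generalize (Real.sqrt p.q : ℂ) = r at *
  rw [div_mul_eq_mul_div, div_mul_eq_mul_div, div_eq_div_iff (by positivity) (by positivity), ← hs]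
  ring

/-! ### The Askey-Wilson operator and its symmetry with respect to u. -/

variable (p : Params)

/-- The value of `f` at `x = (z + 1/z) / 2`. -/
noncomputable def joukowski (f : ℂ[X]) (z : ℂ) : ℂ := f.eval ((z + z⁻¹) / 2)

theorem joukowski_inv (f : ℂ[X]) (z : ℂ) : joukowski f z⁻¹ = joukowski f z := by
  simp [joukowski, add_comm]

theorem joukowski_mul (f g : ℂ[X]) (z : ℂ) :
    joukowski (f * g) z = joukowski f z * joukowski g z := by
  simp [joukowski]

theorem differentiableAt_joukowski (f : ℂ[X]) {z : ℂ} (hz : z ≠ 0) :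
    DifferentiableAt ℂ (joukowski f) z := by
  unfold joukowski
  have h : DifferentiableAt ℂ (fun z : ℂ => (z + z⁻¹) / 2) z := by fun_prop (disch := exact hz)
  exact f.differentiable.differentiableAt.comp z h

/-- The weight in the variable `θ`, `x = cos θ`. -/
noncomputable def weight (θ : ℝ) : ℂ :=
  p.massConst * (p.halfWeight (Complex.exp (θ * Complex.I)) *
    p.halfWeight (Complex.exp (-(θ * Complex.I))))

/-- The coefficient `A(z)` of the Askey-Wilson operator. -/
noncomputable def awCoeff (z : ℂ) : ℂ :=
  (1 - p.a * z) * (1 - p.b * z) * (1 - p.c * z) * (1 - p.d * z) /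
    ((1 - z ^ 2) * (1 - p.Q * z ^ 2))

/-- The integrand `N(q z) N(1/z) f(β z) g(z)`. -/
noncomputable def shiftKernel (f g : ℂ[X]) (β z : ℂ) : ℂ :=
  p.halfWeight (p.Q * z) * p.halfWeight z⁻¹ * (joukowski f (β * z) * joukowski g z)

/-- `f` is an eigenfunction of the Askey-Wilson operator. -/
def IsEigen (f : ℂ[X]) (l : ℂ) : Prop :=
  ∀ z : ℂ, z ≠ 0 → z ^ 2 ≠ 1 → p.Q * z ^ 2 ≠ 1 → p.Q ≠ z ^ 2 →
    l * joukowski f z = p.awCoeff z * (joukowski f (p.Q * z) - joukowski f z) +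
      p.awCoeff z⁻¹ * (joukowski f (p.Q * z⁻¹) - joukowski f z)

variable {p}

theorem u_eq_integral (hp : p.Admissible) (f : ℂ[X]) :
    p.u f = ∫ θ in (0 : ℝ)..Real.pi, f.eval (Real.cos θ : ℂ) * p.weight θ := by
  have himg : Real.cos '' Set.Ioo 0 Real.pi = Set.Ioo (-1) 1 := by
    ext t
    constructor
    · rintro ⟨θ, ⟨h0, h1⟩, rfl⟩
      constructor
      · rw [← Real.cos_pi]
        exact Real.cos_lt_cos_of_nonneg_of_le_pi h0.le le_rfl h1
      · rw [← Real.cos_zero]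
        exact Real.cos_lt_cos_of_nonneg_of_le_pi le_rfl h1.le h0
    · rintro ⟨h0, h1⟩
      exact ⟨Real.arccos t, ⟨Real.arccos_pos.2 h1, by
        rw [← Real.arccos_neg_one]
        exact Real.arccos_lt_arccos le_rfl h0 h1.le⟩, Real.cos_arccos h0.le h1.le⟩
  unfold u
  rw [intervalIntegral.integral_of_le (by norm_num), intervalIntegral.integral_of_le Real.pi_pos.le,
    MeasureTheory.integral_Ioc_eq_integral_Ioo, MeasureTheory.integral_Ioc_eq_integral_Ioo, ← himg,
    MeasureTheory.integral_image_eq_integral_abs_deriv_smul measurableSet_Ioo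
      (fun θ _ => (Real.hasDerivAt_cos θ).hasDerivWithinAt)
      (Real.injOn_cos.mono Set.Ioo_subset_Icc_self)]
  refine MeasureTheory.setIntegral_congr_fun measurableSet_Ioo fun θ hθ => ?_
  have hs : 0 < Real.sin θ := Real.sin_pos_of_pos_of_lt_pi hθ.1 hθ.2
  simp only [abs_neg, abs_of_pos hs, weight, Complex.real_smul]
  rw [← sin_mul_rho_cos hp hθ.1 hθ.2]
  ring

theorem norm_exp_le (θ : ℝ) : ‖Complex.exp (θ * Complex.I)‖ = 1 ∧
    ‖Complex.exp (-(θ * Complex.I))‖ = 1 := by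
  refine ⟨Complex.norm_exp_ofReal_mul_I θ, ?_⟩
  have := Complex.norm_exp_ofReal_mul_I (-θ)
  simpa using this

theorem continuous_halfWeight_comp (hp : p.Admissible) {g : ℝ → ℂ} (hg : Continuous g)
    (h : ∀ θ, ‖g θ‖ ≤ 1) : Continuous fun θ => p.halfWeight (g θ) :=
  continuous_iff_continuousAt.2 fun θ =>
    ContinuousAt.comp (g := p.halfWeight) (f := g)
      (differentiableAt_halfWeight hp (h θ)).continuousAt hg.continuousAt

theorem continuous_weight (hp : p.Admissible) : Continuous p.weight := by
  unfold weight
  exact continuous_const.mul ((continuous_halfWeight_comp hp (by fun_prop)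
    fun θ => (norm_exp_le θ).1.le).mul (continuous_halfWeight_comp hp (by fun_prop)
    fun θ => (norm_exp_le θ).2.le))

theorem exp_conj (θ : ℝ) :
    starRingEnd ℂ (Complex.exp (θ * Complex.I)) = Complex.exp (-(θ * Complex.I)) := by
  rw [← Complex.exp_conj]; simp

open scoped ComplexOrder in
-- On the unit circle 1/z is the conjugate of z, so N(z)N(1/z) = |N(z)|².
theorem weight_pos (hp : p.Admissible) {θ : ℝ} (h0 : 0 < θ) (h1 : θ < Real.pi) :
    0 < p.weight θ := by
  unfold weight
  refine mul_pos (massConst_pos hp) ?_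
  rw [← exp_conj, ← conj_halfWeight hp, Complex.mul_conj]
  have him : (Complex.exp (θ * Complex.I)).im ≠ 0 := by
    rw [Complex.exp_ofReal_mul_I_im]
    exact (Real.sin_pos_of_pos_of_lt_pi h0 h1).ne'
  have := halfWeight_ne_zero hp (norm_exp_le θ).1.le (fun h => him (by simp [h]))
    (fun h => him (by simp [h]))
  exact_mod_cast Complex.normSq_pos.2 this

/-- Integral over the circle of an even function of `θ`. -/
theorem integral_two_pi_of_even {g : ℝ → ℂ} (hg : Continuous g) (hp : g.Periodic (2 * Real.pi))
    (he : ∀ θ, g (-θ) = g θ) :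
    ∫ θ in (0 : ℝ)..(2 * Real.pi), g θ = 2 * ∫ θ in (0 : ℝ)..Real.pi, g θ := by
  have h1 : ∫ θ in (0 : ℝ)..(2 * Real.pi), g θ = ∫ θ in (-Real.pi)..Real.pi, g θ := by
    have := hp.intervalIntegral_add_eq 0 (-Real.pi)
    rw [zero_add, show -Real.pi + 2 * Real.pi = Real.pi by ring] at this
    exact this
  have h2 : ∫ θ in (-Real.pi)..0, g θ = ∫ θ in (0 : ℝ)..Real.pi, g θ := by
    have := intervalIntegral.integral_comp_neg (a := 0) (b := Real.pi) g
    simp only [he, neg_zero] at this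
    exact this.symm
  rw [h1, ← intervalIntegral.integral_add_adjacent_intervals (hg.intervalIntegrable _ 0)
    (hg.intervalIntegrable 0 _), h2, two_mul]

theorem integral_two_pi_comp_neg {g : ℝ → ℂ} (hp : g.Periodic (2 * Real.pi)) :
    ∫ θ in (0 : ℝ)..(2 * Real.pi), g (-θ) = ∫ θ in (0 : ℝ)..(2 * Real.pi), g θ := by
  rw [intervalIntegral.integral_comp_neg, neg_zero]
  have := hp.intervalIntegral_add_eq (-(2 * Real.pi)) 0
  rw [zero_add, neg_add_cancel] at this
  exact this

theorem exp_periodic (g : ℂ → ℂ) :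
    (fun θ : ℝ => g (Complex.exp (θ * Complex.I))).Periodic (2 * Real.pi) := by
  intro θ
  have : ((θ + 2 * Real.pi : ℝ) : ℂ) * Complex.I = θ * Complex.I + 2 * Real.pi * Complex.I := by
    push_cast; ring
  simp only [this, Complex.exp_periodic _]

/-- Cauchy's theorem on the annulus for H(z)/z, whose integral over |z| = R is i times the integral
of H(R e^{iθ}). -/
theorem circle_shift {H : ℂ → ℂ} {q : ℝ} (h0 : 0 < q) (h1 : q < 1)
    (hH : ∀ z : ℂ, 1 ≤ ‖z‖ → ‖z‖ ≤ q⁻¹ → DifferentiableAt ℂ H z) :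
    ∫ θ in (0 : ℝ)..(2 * Real.pi), H (Complex.exp (θ * Complex.I)) =
      ∫ θ in (0 : ℝ)..(2 * Real.pi), H (q⁻¹ * Complex.exp (θ * Complex.I)) := by
  have key : ∀ R : ℝ, R ≠ 0 → (∮ z in C(0, R), (z - 0)⁻¹ • H z) =
      Complex.I * ∫ θ in (0 : ℝ)..(2 * Real.pi), H (R * Complex.exp (θ * Complex.I)) := by
    intro R hR
    rw [circleIntegral, ← intervalIntegral.integral_const_mul]
    refine intervalIntegral.integral_congr fun θ _ => ?_
    have : (R : ℂ) * Complex.exp (θ * Complex.I) ≠ 0 :=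
      mul_ne_zero (by exact_mod_cast hR) (Complex.exp_ne_zero _)
    simp only [deriv_circleMap, circleMap, zero_add, sub_zero, smul_eq_mul]
    field_simp [(show (R : ℂ) ≠ 0 by exact_mod_cast hR)]
  have hq1 : 1 ≤ q⁻¹ := (one_le_inv₀ h0).2 h1.le
  have hmem : ∀ z : ℂ, z ∈ Metric.closedBall (0 : ℂ) q⁻¹ \ Metric.ball 0 1 →
      DifferentiableAt ℂ H z := fun z hz =>
    hH z (by simpa using hz.2) (by simpa using hz.1)
  have := Complex.circleIntegral_sub_center_inv_smul_eq_of_differentiable_on_annulus_off_countable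
    (c := 0) (f := H) one_pos hq1 Set.countable_empty
    (fun z hz => (hmem z hz).continuousAt.continuousWithinAt)
    (fun z hz => hmem z ⟨Metric.ball_subset_closedBall hz.1.1,
      fun h => hz.1.2 (Metric.ball_subset_closedBall h)⟩)
  rw [key _ (by positivity), key _ one_ne_zero] at this
  have := mul_left_cancel₀ Complex.I_ne_zero this
  simpa using this.symm

/-- The bilinear form attached to the shift `f(z) ↦ f(q z)` is symmetric. -/
theorem shift_integral_symm (hp : p.Admissible) (f g : ℂ[X]) :
    ∫ θ in (0 : ℝ)..(2 * Real.pi), p.shiftKernel f g p.Q (Complex.exp (θ * Complex.I)) =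
      ∫ θ in (0 : ℝ)..(2 * Real.pi), p.shiftKernel g f p.Q (Complex.exp (θ * Complex.I)) := by
  have hQ := hp.Q_ne_zero
  -- On |z| = 1/q write z = 1/(qw) with |w| = 1. Then N(qz)N(1/z) = N(1/w)N(qw), and invariance
  -- under inversion turns f(qz)g(z) into f(w)g(qw).
  rw [circle_shift hp.q_pos hp.q_lt_one,
    ← integral_two_pi_comp_neg (exp_periodic (p.shiftKernel g f p.Q))]
  · refine intervalIntegral.integral_congr fun θ _ => ?_
    have he : Complex.exp (((-θ : ℝ) : ℂ) * Complex.I) = (Complex.exp (θ * Complex.I))⁻¹ := by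
      rw [← Complex.exp_neg]; simp
    have hQ' : ((p.q⁻¹ : ℝ) : ℂ) = p.Q⁻¹ := by simp [Q]
    simp only [he, shiftKernel]
    generalize Complex.exp (θ * Complex.I) = z
    rw [hQ', inv_inv, mul_inv, inv_inv, mul_inv_cancel_left₀ hQ,
      joukowski_inv, ← joukowski_inv g (p.Q⁻¹ * z), mul_inv, inv_inv]
    ring
  -- For 1 ≤ |z| ≤ 1/q both qz and 1/z lie in the closed unit disc, where N is holomorphic.
  · intro z h1 h2
    have hz : z ≠ 0 := norm_pos_iff.1 (one_pos.trans_le h1)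
    have hn : ‖p.Q * z‖ ≤ 1 := by
      rw [norm_mul, Q, Complex.norm_real, Real.norm_of_nonneg hp.q_pos.le]
      have := mul_le_mul_of_nonneg_left h2 hp.q_pos.le
      rwa [mul_inv_cancel₀ hp.q_pos.ne'] at this
    have hn' : ‖z⁻¹‖ ≤ 1 := by
      rw [norm_inv]; exact inv_le_one_of_one_le₀ h1
    have d1 : DifferentiableAt ℂ (fun z => p.halfWeight (p.Q * z)) z :=
      (differentiableAt_halfWeight hp hn).comp z (by fun_prop)
    have d2 : DifferentiableAt ℂ (fun z => p.halfWeight z⁻¹) z :=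
      DifferentiableAt.comp z (differentiableAt_halfWeight hp hn') (differentiableAt_inv hz)
    have d3 : DifferentiableAt ℂ (fun z => joukowski f (p.Q * z)) z :=
      (differentiableAt_joukowski f (mul_ne_zero hQ hz)).comp z (by fun_prop)
    unfold shiftKernel
    exact (d1.mul d2).mul (d3.mul (differentiableAt_joukowski g hz))

theorem halfWeight_mul_awCoeff (hp : p.Admissible) {z : ℂ} (hz : ‖z‖ = 1) (h : z ^ 2 ≠ 1) :
    p.halfWeight z * p.awCoeff z = p.halfWeight (p.Q * z) := by
  have h1 : 1 - z ^ 2 ≠ 0 := sub_ne_zero.2 h.symm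
  have h2 : 1 - p.Q * z ^ 2 ≠ 0 := by
    intro h0
    have h3 : ‖p.Q * z ^ 2‖ < 1 := by simpa [hz] using hp.norm_Q_lt
    rw [← sub_eq_zero.1 h0] at h3
    simp at h3
  rw [awCoeff, mul_div_assoc', halfWeight_mul hp hz.le, mul_div_assoc, div_self (mul_ne_zero h1 h2),
    mul_one]

theorem joukowski_exp (f : ℂ[X]) (θ : ℝ) :
    joukowski f (Complex.exp (θ * Complex.I)) = f.eval (Real.cos θ : ℂ) := by
  rw [joukowski, ← Complex.exp_neg, Complex.ofReal_cos, Complex.cos, neg_mul]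

theorem continuous_shift_aux (hp : p.Admissible) (f g : ℂ[X]) (β : ℂ) (hβ : β ≠ 0) :
    Continuous fun θ : ℝ => p.shiftKernel f g β (Complex.exp (θ * Complex.I)) := by
  have hj : ∀ (f : ℂ[X]) (g : ℝ → ℂ), Continuous g → (∀ θ, g θ ≠ 0) →
      Continuous fun θ => joukowski f (g θ) := fun f g hg h =>
    continuous_iff_continuousAt.2 fun θ => ContinuousAt.comp (g := joukowski f) (f := g)
      (differentiableAt_joukowski f (h θ)).continuousAt hg.continuousAt
  unfold shiftKernel
  refine ((continuous_halfWeight_comp hp (by fun_prop) fun θ => ?_).mul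
    (continuous_halfWeight_comp hp ?_ fun θ => ?_)).mul ((hj _ _ (by fun_prop) fun θ => ?_).mul
    (hj _ _ (by fun_prop) fun θ => ?_))
  · rw [norm_mul, (norm_exp_le θ).1, mul_one]; exact hp.norm_Q_lt.le
  · simp only [← Complex.exp_neg]; fun_prop
  · rw [norm_inv, (norm_exp_le θ).1, inv_one]
  · exact mul_ne_zero hβ (Complex.exp_ne_zero _)
  · exact Complex.exp_ne_zero _

/-- Multiplying the eigenvalue equation by N(z)N(1/z)g(z) and using N(z)A(z) = N(qz) turns it into
S(z) + S(1/z); the half-circle integral then unfolds to a full-circle integral of S. Of the two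
resulting terms, the one with shift 1 is visibly symmetric in f and g, the one with shift q by
`shift_integral_symm`. -/
theorem IsEigen.integral_eq (hp : p.Admissible) {f : ℂ[X]} {l : ℂ} (hf : p.IsEigen f l)
    (g : ℂ[X]) :
    l * p.u (f * g) = p.massConst *
      ((∫ θ in (0 : ℝ)..(2 * Real.pi), p.shiftKernel f g p.Q (Complex.exp (θ * Complex.I))) -
      ∫ θ in (0 : ℝ)..(2 * Real.pi), p.shiftKernel f g 1 (Complex.exp (θ * Complex.I))) := by
  set S : ℂ → ℂ := fun z => p.shiftKernel f g p.Q z - p.shiftKernel f g 1 z with hS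
  have hc : Continuous fun θ : ℝ => S (Complex.exp (θ * Complex.I)) :=
    (continuous_shift_aux hp f g p.Q hp.Q_ne_zero).sub (continuous_shift_aux hp f g 1 one_ne_zero)
  have hexp : ∀ θ : ℝ, Complex.exp (((-θ : ℝ) : ℂ) * Complex.I) =
      (Complex.exp (θ * Complex.I))⁻¹ := fun θ => by rw [← Complex.exp_neg]; simp
  have hkey : ∀ z : ℂ, ‖z‖ = 1 → l * (p.halfWeight z * p.halfWeight z⁻¹ * joukowski (f * g) z) =
      S z + S z⁻¹ := by
    intro z hz
    have hz0 : z ≠ 0 := norm_pos_iff.1 (by rw [hz]; exact one_pos)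
    have hz' : ‖z⁻¹‖ = 1 := by rw [norm_inv, hz, inv_one]
    by_cases h : z ^ 2 = 1
    · have h0 : p.halfWeight z = 0 ∧ p.halfWeight z⁻¹ = 0 := by
        rcases mul_self_eq_one_iff.1 ((sq z).symm.trans h) with rfl | rfl
        · simp [halfWeight_one hp]
        · simp [halfWeight_neg_one hp, inv_neg]
      simp [hS, shiftKernel, h0]
    · have hq1 : p.Q * z ^ 2 ≠ 1 := fun h0 => by
        have h3 : ‖p.Q * z ^ 2‖ < 1 := by simpa [hz] using hp.norm_Q_lt
        rw [h0] at h3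
        simp at h3
      have hq2 : p.Q ≠ z ^ 2 := fun h0 => by
        have h3 := hp.norm_Q_lt
        rw [h0] at h3
        simp [hz] at h3
      have h1 := hf z hz0 h hq1 hq2
      have h2 := halfWeight_mul_awCoeff hp hz h
      have h3 := halfWeight_mul_awCoeff hp hz' (by rwa [inv_pow, ne_eq, inv_eq_one])
      simp only [hS, shiftKernel, joukowski_mul, inv_inv, one_mul, joukowski_inv]
      rw [← h2, ← h3]
      linear_combination (p.halfWeight z * p.halfWeight z⁻¹ * joukowski g z) * h1
  have hper := exp_periodic S
  rw [u_eq_integral hp, ← intervalIntegral.integral_sub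
    ((continuous_shift_aux hp f g p.Q hp.Q_ne_zero).intervalIntegrable _ _)
    ((continuous_shift_aux hp f g 1 one_ne_zero).intervalIntegrable _ _)]
  change _ = p.massConst * ∫ θ in (0 : ℝ)..(2 * Real.pi), S (Complex.exp (θ * Complex.I))
  set T : ℝ → ℂ := fun θ => S (Complex.exp (θ * Complex.I)) with hT
  have hTn : Continuous fun θ => T (-θ) := hc.comp continuous_neg
  have h1 : ∫ θ in (0 : ℝ)..(2 * Real.pi), (T θ + T (-θ)) =
      2 * ∫ θ in (0 : ℝ)..(2 * Real.pi), T θ := by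
    rw [intervalIntegral.integral_add (hc.intervalIntegrable _ _) (hTn.intervalIntegrable _ _),
      integral_two_pi_comp_neg hper]
    ring
  have h2 : ∫ θ in (0 : ℝ)..(2 * Real.pi), (T θ + T (-θ)) =
      2 * ∫ θ in (0 : ℝ)..Real.pi, (T θ + T (-θ)) := by
    refine integral_two_pi_of_even (hc.add hTn) (fun θ => ?_) fun θ => ?_
    · have e1 : T (θ + 2 * Real.pi) = T θ := hper θ
      have e2 : T (-(θ + 2 * Real.pi)) = T (-θ) := by
        have := hper (-(θ + 2 * Real.pi))
        rw [show -(θ + 2 * Real.pi) + 2 * Real.pi = -θ by ring] at this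
        exact this.symm
      rw [e1, e2]
    · rw [neg_neg, add_comm]
  rw [← mul_left_cancel₀ two_ne_zero (h2.symm.trans h1), ← intervalIntegral.integral_const_mul,
    ← intervalIntegral.integral_const_mul]
  refine intervalIntegral.integral_congr fun θ _ => ?_
  have := hkey (Complex.exp (θ * Complex.I)) (norm_exp_le θ).1
  simp only [hT, hexp, weight]
  rw [← this, joukowski_exp, Complex.exp_neg]
  ring

/-- Eigenfunctions of the Askey-Wilson operator for distinct eigenvalues are orthogonal. -/
theorem u_mul_eq_zero_of_isEigen (hp : p.Admissible) {f g : ℂ[X]} {l m : ℂ}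
    (hf : p.IsEigen f l) (hg : p.IsEigen g m) (hlm : l ≠ m) : p.u (f * g) = 0 := by
  have h1 := hf.integral_eq hp g
  have h2 := hg.integral_eq hp f
  rw [shift_integral_symm hp g f, mul_comm g f] at h2
  have h3 : ∀ z, p.shiftKernel g f 1 z = p.shiftKernel f g 1 z := fun z => by
    simp only [shiftKernel, one_mul, mul_comm (joukowski f z)]
  simp only [h3] at h2
  have h4 : (l - m) * p.u (f * g) = 0 := by
    rw [sub_mul, h1, h2, sub_self]
  exact (mul_eq_zero.1 h4).resolve_left (sub_ne_zero.2 hlm)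

end Params

/-! ### Expansion of P_n in (az, a/z; q)_k and the eigenvalue equation. -/

theorem qPoch_zero (q z : ℂ) : qPoch q z 0 = 1 := by simp [qPoch]

theorem qPoch_succ (q z : ℂ) (k : ℕ) : qPoch q z (k + 1) = qPoch q z k * (1 - z * q ^ k) :=
  Finset.prod_range_succ _ _

theorem qPoch_succ' (q z : ℂ) (k : ℕ) : qPoch q z (k + 1) = (1 - z) * qPoch q (z * q) k := by
  rw [qPoch, Finset.prod_range_succ', mul_comm, qPoch]
  simp [pow_succ', mul_assoc]

theorem one_sub_ne_zero_of_norm_lt {z : ℂ} (hz : ‖z‖ < 1) : 1 - z ≠ 0 := by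
  intro h
  rw [← sub_eq_zero.1 h] at hz
  simp at hz

theorem one_sub_mul_pow_ne_zero {q z : ℂ} (hq : ‖q‖ ≤ 1) (hz : ‖z‖ < 1) (i : ℕ) :
    1 - z * q ^ i ≠ 0 := by
  refine one_sub_ne_zero_of_norm_lt ?_
  rw [norm_mul, norm_pow]
  exact mul_lt_one_of_nonneg_of_lt_one_left (norm_nonneg _) hz (pow_le_one₀ (norm_nonneg _) hq)

theorem qPoch_ne_zero {q z : ℂ} (hq : ‖q‖ ≤ 1) (hz : ‖z‖ < 1) (k : ℕ) : qPoch q z k ≠ 0 :=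
  Finset.prod_ne_zero_iff.2 fun i _ => one_sub_mul_pow_ne_zero hq hz i

namespace Params

variable (p : Params)

/-- The coefficients of `P_n` in the basis `(a z, a / z; q)_k`. -/
noncomputable def coef (n k : ℕ) : ℂ :=
  p.lead n * ((qPoch p.Q (p.Q ^ (-(n : ℤ))) k * qPoch p.Q (p.abcd * p.Q ^ ((n : ℤ) - 1)) k) /
    (qPoch p.Q (p.a * p.b) k * qPoch p.Q (p.a * p.c) k * qPoch p.Q (p.a * p.d) k *
      qPoch p.Q p.Q k) * p.Q ^ k)

/-- The basis functions `(a z, a / z; q)_k`. -/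
noncomputable def basis (k : ℕ) (z : ℂ) : ℂ :=
  qPoch p.Q (p.a * z) k * qPoch p.Q (p.a * z⁻¹) k

/-- `(1 - q^k)(1 - a q^{k-1} z) (a z, a / z; q)_{k-1}`, up to a factor the first difference of
`(a z, a / z; q)_k`. -/
noncomputable def basisDiff : ℕ → ℂ → ℂ
  | 0, _ => 0
  | k + 1, z => (1 - p.Q ^ (k + 1)) * (1 - p.a * p.Q ^ k * z) * p.basis k z

variable {p}

theorem basis_zero (z : ℂ) : p.basis 0 z = 1 := by simp [basis, qPoch_zero]

theorem basis_succ (k : ℕ) (z : ℂ) : p.basis (k + 1) z =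
    p.basis k z * ((1 - p.a * z * p.Q ^ k) * (1 - p.a * z⁻¹ * p.Q ^ k)) := by
  rw [basis, qPoch_succ, qPoch_succ, basis]
  ring

theorem basis_inv (k : ℕ) (z : ℂ) : p.basis k z⁻¹ = p.basis k z := by
  rw [basis, basis, inv_inv, mul_comm]

theorem joukowski_P {z : ℂ} (hz : z ≠ 0) (n : ℕ) :
    joukowski (p.P n) z = ∑ k ∈ Finset.range (n + 1), p.coef n k * p.basis k z := by
  unfold joukowski P
  simp only [eval_mul, eval_C, eval_finsetSum, eval_prod, eval_add, eval_sub, eval_one, eval_X]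
  rw [Finset.mul_sum]
  refine Finset.sum_congr rfl fun k _ => ?_
  have : ∏ i ∈ Finset.range k, (1 - 2 * p.a * p.Q ^ i * ((z + z⁻¹) / 2) +
      p.a ^ 2 * p.Q ^ (2 * i)) = p.basis k z := by
    rw [basis, qPoch, qPoch, ← Finset.prod_mul_distrib]
    refine Finset.prod_congr rfl fun i _ => ?_
    linear_combination (-(p.a ^ 2 * p.Q ^ (2 * i))) * mul_inv_cancel₀ hz
  rw [this, coef]
  ring

/-- The factor 1 - az avoids a division: (aqz; q)_k and (az; q)_k differ by the ratio (1 - aq^k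
z)/(1 - az). -/
theorem basis_shift (hp : p.Admissible) {z : ℂ} (hz : z ≠ 0) (k : ℕ) :
    (1 - p.a * z) * (p.basis k (p.Q * z) - p.basis k z) =
      p.a * (z - (p.Q * z)⁻¹) * p.basisDiff k z := by
  have hQ := hp.Q_ne_zero
  cases k with
  | zero => simp [basis_zero, basisDiff]
  | succ k =>
    have h1 : (1 - p.a * z) * qPoch p.Q (p.a * (p.Q * z)) (k + 1) =
        qPoch p.Q (p.a * z) k * (1 - p.a * z * p.Q ^ k) * (1 - p.a * z * p.Q ^ (k + 1)) := by
      rw [← qPoch_succ, ← qPoch_succ, qPoch_succ' _ _ (k + 1)]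
      ring_nf
    have h2 : qPoch p.Q (p.a * (p.Q * z)⁻¹) (k + 1) =
        (1 - p.a * (p.Q * z)⁻¹) * qPoch p.Q (p.a * z⁻¹) k := by
      rw [qPoch_succ']
      congr 2
      field_simp
    rw [mul_sub, basis, ← mul_assoc, h1, h2, basis_succ, basisDiff, basis, pow_succ]
    generalize qPoch p.Q (p.a * z) k = e
    generalize qPoch p.Q (p.a * z⁻¹) k = e'
    generalize p.Q ^ k = t
    field_simp
    ring

namespace Admissible

theorem one_sub_ab (hp : p.Admissible) (k : ℕ) : 1 - p.a * p.b * p.Q ^ k ≠ 0 :=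
  one_sub_mul_pow_ne_zero hp.norm_Q_lt.le (norm_mul_lt hp.norm_a hp.norm_b) k

theorem one_sub_ac (hp : p.Admissible) (k : ℕ) : 1 - p.a * p.c * p.Q ^ k ≠ 0 :=
  one_sub_mul_pow_ne_zero hp.norm_Q_lt.le (norm_mul_lt hp.norm_a hp.norm_c) k

theorem one_sub_ad (hp : p.Admissible) (k : ℕ) : 1 - p.a * p.d * p.Q ^ k ≠ 0 :=
  one_sub_mul_pow_ne_zero hp.norm_Q_lt.le (norm_mul_lt hp.norm_a hp.norm_d) k

theorem one_sub_bc (hp : p.Admissible) (k : ℕ) : 1 - p.b * p.c * p.Q ^ k ≠ 0 :=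
  one_sub_mul_pow_ne_zero hp.norm_Q_lt.le (norm_mul_lt hp.norm_b hp.norm_c) k

theorem one_sub_bd (hp : p.Admissible) (k : ℕ) : 1 - p.b * p.d * p.Q ^ k ≠ 0 :=
  one_sub_mul_pow_ne_zero hp.norm_Q_lt.le (norm_mul_lt hp.norm_b hp.norm_d) k

theorem one_sub_cd (hp : p.Admissible) (k : ℕ) : 1 - p.c * p.d * p.Q ^ k ≠ 0 :=
  one_sub_mul_pow_ne_zero hp.norm_Q_lt.le (norm_mul_lt hp.norm_c hp.norm_d) k

theorem one_sub_abcd (hp : p.Admissible) (k : ℕ) : 1 - p.abcd * p.Q ^ k ≠ 0 :=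
  one_sub_mul_pow_ne_zero hp.norm_Q_lt.le hp.norm_abcd_lt k

theorem one_sub_Q_pow (hp : p.Admissible) (k : ℕ) : 1 - p.Q ^ (k + 1) ≠ 0 := by
  rw [pow_succ']
  exact one_sub_mul_pow_ne_zero hp.norm_Q_lt.le hp.norm_Q_lt k

theorem qPoch_abcd_ne_zero (hp : p.Admissible) (n : ℕ) :
    qPoch p.Q (p.abcd * p.Q ^ ((n : ℤ) - 1)) n ≠ 0 := by
  cases n with
  | zero => simp [qPoch_zero]
  | succ m =>
    have : ((m + 1 : ℕ) : ℤ) - 1 = m := by push_cast; ring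
    rw [this, zpow_natCast]
    refine Finset.prod_ne_zero_iff.2 fun i _ => ?_
    rw [mul_assoc, ← pow_add]
    exact hp.one_sub_abcd _

end Admissible

/-- The term ratio of the ₄φ₃, cleared of denominators; both telescoping arguments below rest on it.
-/
theorem coef_succ (hp : p.Admissible) (n k : ℕ) :
    p.coef n (k + 1) * ((1 - p.a * p.b * p.Q ^ k) * (1 - p.a * p.c * p.Q ^ k) *
        (1 - p.a * p.d * p.Q ^ k) * (1 - p.Q ^ (k + 1))) =
      p.coef n k * ((1 - p.Q ^ (-(n : ℤ)) * p.Q ^ k) *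
        (1 - p.abcd * p.Q ^ ((n : ℤ) - 1) * p.Q ^ k) * p.Q) := by
  have hQ := hp.norm_Q_lt.le
  have h1 := hp.one_sub_ab k
  have h2 := hp.one_sub_ac k
  have h3 := hp.one_sub_ad k
  have h4 := hp.one_sub_Q_pow k
  have e1 := qPoch_ne_zero hQ (Admissible.norm_mul_lt hp.norm_a hp.norm_b) k
  have e2 := qPoch_ne_zero hQ (Admissible.norm_mul_lt hp.norm_a hp.norm_c) k
  have e3 := qPoch_ne_zero hQ (Admissible.norm_mul_lt hp.norm_a hp.norm_d) k
  have e4 := qPoch_ne_zero hQ hp.norm_Q_lt k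
  unfold coef
  simp only [qPoch_succ]
  rw [pow_succ'] at h4
  rw [pow_succ']
  generalize qPoch p.Q (p.a * p.b) k = E1 at *
  generalize qPoch p.Q (p.a * p.c) k = E2 at *
  generalize qPoch p.Q (p.a * p.d) k = E3 at *
  generalize qPoch p.Q p.Q k = E4 at *
  generalize qPoch p.Q _ k = E5
  generalize qPoch p.Q _ k = E6
  generalize p.Q ^ k = K at *
  generalize p.Q ^ (-(n : ℤ)) = N
  generalize p.abcd * p.Q ^ ((n : ℤ) - 1) = D
  generalize 1 - p.a * p.b * K = F1 at *
  generalize 1 - p.a * p.c * K = F2 at *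
  generalize 1 - p.a * p.d * K = F3 at *
  generalize 1 - p.Q * K = F4 at *
  field_simp

theorem coef_self_succ (hp : p.Admissible) (n : ℕ) : p.coef n (n + 1) = 0 := by
  rw [coef, p.qPoch_neg_eq_zero hp.q_pos n.lt_succ_self]
  simp

theorem lead_succ (hp : p.Admissible) (m : ℕ) :
    p.lead (m + 1) * (2 * p.a * (1 - p.abcd * p.Q ^ ((m : ℤ) - 1) * p.Q ^ m) *
        (1 - p.abcd * p.Q ^ ((m : ℤ) - 1) * p.Q ^ (m + 1))) =
      p.lead m * ((1 - p.a * p.b * p.Q ^ m) * (1 - p.a * p.c * p.Q ^ m) *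
        (1 - p.a * p.d * p.Q ^ m) * (1 - p.abcd * p.Q ^ ((m : ℤ) - 1))) := by
  have hQ := hp.Q_ne_zero
  have hm := hp.qPoch_abcd_ne_zero m
  have hm1 := hp.qPoch_abcd_ne_zero (m + 1)
  have hs : p.abcd * p.Q ^ (((m + 1 : ℕ) : ℤ) - 1) = p.abcd * p.Q ^ ((m : ℤ) - 1) * p.Q := by
    rw [mul_assoc, ← zpow_add_one₀ hQ]
    push_cast; ring_nf
  have key : qPoch p.Q (p.abcd * p.Q ^ ((m : ℤ) - 1)) m *
      (1 - p.abcd * p.Q ^ ((m : ℤ) - 1) * p.Q ^ m) *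
      (1 - p.abcd * p.Q ^ ((m : ℤ) - 1) * p.Q ^ (m + 1)) =
      (1 - p.abcd * p.Q ^ ((m : ℤ) - 1)) *
        qPoch p.Q (p.abcd * p.Q ^ ((m : ℤ) - 1) * p.Q) (m + 1) := by
    rw [← qPoch_succ, ← qPoch_succ, qPoch_succ']
  have ha := hp.a_ne_zero
  unfold lead
  rw [hs] at hm1 ⊢
  simp only [qPoch_succ _ (_ * _) m] at hm1 key ⊢
  rw [div_mul_eq_mul_div, div_mul_eq_mul_div, div_eq_div_iff
    (mul_ne_zero (pow_ne_zero _ (mul_ne_zero two_ne_zero ha)) hm1)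
    (mul_ne_zero (pow_ne_zero _ (mul_ne_zero two_ne_zero ha)) hm)]
  linear_combination (qPoch p.Q (p.a * p.b) m * (1 - p.a * p.b * p.Q ^ m) *
    (qPoch p.Q (p.a * p.c) m * (1 - p.a * p.c * p.Q ^ m)) *
    (qPoch p.Q (p.a * p.d) m * (1 - p.a * p.d * p.Q ^ m)) * (2 * p.a) ^ (m + 1)) * key

/-- Passing from m + 1 to m shifts q^{-n} and abcd q^{n-1} by one power of q, so each of the two
shifted factorials exchanges one end factor. -/
theorem coef_pred (hp : p.Admissible) (m k : ℕ) :
    p.coef m k * ((1 - p.a * p.b * p.Q ^ m) * (1 - p.a * p.c * p.Q ^ m) *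
        (1 - p.a * p.d * p.Q ^ m) * (1 - p.Q ^ (-((m + 1 : ℕ) : ℤ))) *
        (1 - p.abcd * p.Q ^ ((m : ℤ) - 1) * p.Q ^ k)) =
      p.coef (m + 1) k * (2 * p.a * (1 - p.abcd * p.Q ^ ((m : ℤ) - 1) * p.Q ^ m) *
        (1 - p.abcd * p.Q ^ ((m : ℤ) - 1) * p.Q ^ (m + 1)) *
        (1 - p.Q ^ (-((m + 1 : ℕ) : ℤ)) * p.Q ^ k)) := by
  have hQ := hp.Q_ne_zero
  have hs : p.abcd * p.Q ^ (((m + 1 : ℕ) : ℤ) - 1) = p.abcd * p.Q ^ ((m : ℤ) - 1) * p.Q := by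
    rw [mul_assoc, ← zpow_add_one₀ hQ]
    push_cast; ring_nf
  have ht : p.Q ^ (-(m : ℤ)) = p.Q ^ (-((m + 1 : ℕ) : ℤ)) * p.Q := by
    rw [← zpow_add_one₀ hQ]
    push_cast; ring_nf
  have h1 := lead_succ hp m
  have h2 : (1 - p.Q ^ (-((m + 1 : ℕ) : ℤ))) * qPoch p.Q (p.Q ^ (-(m : ℤ))) k =
      qPoch p.Q (p.Q ^ (-((m + 1 : ℕ) : ℤ))) k * (1 - p.Q ^ (-((m + 1 : ℕ) : ℤ)) * p.Q ^ k) := by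
    rw [← qPoch_succ, qPoch_succ', ht]
  have h3 : (1 - p.abcd * p.Q ^ ((m : ℤ) - 1)) *
        qPoch p.Q (p.abcd * p.Q ^ (((m + 1 : ℕ) : ℤ) - 1)) k =
      qPoch p.Q (p.abcd * p.Q ^ ((m : ℤ) - 1)) k *
        (1 - p.abcd * p.Q ^ ((m : ℤ) - 1) * p.Q ^ k) := by
    rw [← qPoch_succ, qPoch_succ', hs]
  unfold coef
  generalize qPoch p.Q (p.Q ^ (-(m : ℤ))) k = E1 at *
  generalize qPoch p.Q (p.Q ^ (-((m + 1 : ℕ) : ℤ))) k = E2 at *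
  generalize qPoch p.Q (p.abcd * p.Q ^ (((m + 1 : ℕ) : ℤ) - 1)) k = E3 at *
  generalize qPoch p.Q (p.abcd * p.Q ^ ((m : ℤ) - 1)) k = E4 at *
  generalize (qPoch p.Q (p.a * p.b) k * qPoch p.Q (p.a * p.c) k * qPoch p.Q (p.a * p.d) k *
      qPoch p.Q p.Q k) = E5 at *
  generalize 1 - p.Q ^ (-((m + 1 : ℕ) : ℤ)) * p.Q ^ k = E6 at *
  generalize 1 - p.Q ^ (-((m + 1 : ℕ) : ℤ)) = E7 at *
  generalize 1 - p.abcd * p.Q ^ ((m : ℤ) - 1) * p.Q ^ k = E8 at *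
  generalize (1 - p.a * p.b * p.Q ^ m) * (1 - p.a * p.c * p.Q ^ m) *
        (1 - p.a * p.d * p.Q ^ m) = E9 at *
  rw [mul_div_assoc, mul_div_assoc]
  linear_combination (-(E2 * E6 * (E3 / E5) * p.Q ^ k)) * h1 +
    (p.lead m * (E4 / E5) * E8 * E9 * p.Q ^ k) * h2 -
    (p.lead m * E9 * E2 * E6 / E5 * p.Q ^ k) * h3

/-- The Askey-Wilson operator is triangular in the basis `(a z, a / z; q)_k`. -/
theorem awOperator_basis (hp : p.Admissible) {z : ℂ} (hz : z ≠ 0) (h1 : z ^ 2 ≠ 1)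
    (h2 : p.Q * z ^ 2 ≠ 1) (h3 : p.Q ≠ z ^ 2) (k : ℕ) :
    p.awCoeff z * (p.basis (k + 1) (p.Q * z) - p.basis (k + 1) z) +
        p.awCoeff z⁻¹ * (p.basis (k + 1) (p.Q * z⁻¹) - p.basis (k + 1) z) =
      ((p.Q ^ (k + 1))⁻¹ - 1) * (1 - p.abcd * p.Q ^ k) * p.basis (k + 1) z -
        (p.Q ^ (k + 1))⁻¹ * ((1 - p.a * p.b * p.Q ^ k) * (1 - p.a * p.c * p.Q ^ k) *
          (1 - p.a * p.d * p.Q ^ k) * (1 - p.Q ^ (k + 1))) * p.basis k z := by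
  have hQ := hp.Q_ne_zero
  have hA : ∀ w : ℂ, w ≠ 0 → w ^ 2 ≠ 1 → p.Q * w ^ 2 ≠ 1 →
      p.awCoeff w * (p.basis (k + 1) (p.Q * w) - p.basis (k + 1) w) =
      -(p.a / p.Q * ((1 - p.b * w) * (1 - p.c * w) * (1 - p.d * w)) / (w * (1 - w ^ 2))) *
        ((1 - p.Q ^ (k + 1)) * (1 - p.a * p.Q ^ k * w) * p.basis k w) := by
    intro w hw hw1 hw2
    have e1 : 1 - w ^ 2 ≠ 0 := sub_ne_zero.2 hw1.symm
    have e2 : 1 - p.Q * w ^ 2 ≠ 0 := sub_ne_zero.2 hw2.symm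
    have hb := basis_shift hp hw (k + 1)
    rw [basisDiff] at hb
    generalize (1 - p.Q ^ (k + 1)) * (1 - p.a * p.Q ^ k * w) * p.basis k w = S at *
    generalize p.basis (k + 1) (p.Q * w) - p.basis (k + 1) w = T at *
    have : p.awCoeff w * T = ((1 - p.b * w) * (1 - p.c * w) * (1 - p.d * w)) /
        ((1 - w ^ 2) * (1 - p.Q * w ^ 2)) * ((1 - p.a * w) * T) := by
      rw [awCoeff]; ring
    have e3 : w - (p.Q * w)⁻¹ = -(1 - p.Q * w ^ 2) / (p.Q * w) := by
      field_simp
      ring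
    rw [this, hb, e3]
    generalize 1 - w ^ 2 = X at *
    generalize 1 - p.Q * w ^ 2 = Y at *
    field_simp
  have hz2 : z ^ 2 ≠ 0 := pow_ne_zero 2 hz
  have h1' : z⁻¹ ^ 2 ≠ 1 := by rwa [inv_pow, ne_eq, inv_eq_one]
  have h2' : p.Q * z⁻¹ ^ 2 ≠ 1 := by
    rw [inv_pow, ← div_eq_mul_inv, ne_eq, div_eq_one_iff_eq hz2]
    exact h3
  rw [hA z hz h1 h2, ← basis_inv (k + 1) z, hA z⁻¹ (inv_ne_zero hz) h1' h2', basis_inv, basis_inv,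
    basis_succ, abcd, pow_succ p.Q k]
  have e1 : 1 - z ^ 2 ≠ 0 := sub_ne_zero.2 h1.symm
  have e1' : z ^ 2 - 1 ≠ 0 := sub_ne_zero.2 h1
  have hK : p.Q ^ k ≠ 0 := pow_ne_zero k hQ
  generalize p.Q ^ k = t at *
  generalize p.basis k z = φ
  have e3 : z⁻¹ * (1 - z⁻¹ ^ 2) = -(1 - z ^ 2) / z ^ 3 := by
    field_simp
    ring
  rw [e3]
  field_simp
  ring

/-- By `awOperator_basis` and `coef_succ` the partial sums of eigenvalue term minus operator term
telescope to a single boundary term. At the end of the series it carries the coefficient of index n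
+ 1, which is zero. -/
theorem isEigen_P (hp : p.Admissible) (n : ℕ) :
    p.IsEigen (p.P n) (((p.Q ^ n)⁻¹ - 1) * (1 - p.abcd * p.Q ^ ((n : ℤ) - 1))) := by
  intro z hz h1 h2 h3
  have hQ := hp.Q_ne_zero
  have hn : p.Q ^ n ≠ 0 := pow_ne_zero n hQ
  rw [joukowski_P hz, joukowski_P (mul_ne_zero hQ hz), joukowski_P (mul_ne_zero hQ (inv_ne_zero hz))]
  set l := ((p.Q ^ n)⁻¹ - 1) * (1 - p.abcd * p.Q ^ ((n : ℤ) - 1)) with hl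
  set op : ℕ → ℂ := fun k => p.awCoeff z * (p.basis k (p.Q * z) - p.basis k z) +
    p.awCoeff z⁻¹ * (p.basis k (p.Q * z⁻¹) - p.basis k z) with hop
  have key : ∀ m, ∑ k ∈ Finset.range (m + 1), p.coef n k * (l * p.basis k z - op k) =
      -((p.Q ^ (m + 1))⁻¹ * (p.coef n (m + 1) * ((1 - p.a * p.b * p.Q ^ m) *
        (1 - p.a * p.c * p.Q ^ m) * (1 - p.a * p.d * p.Q ^ m) * (1 - p.Q ^ (m + 1)))) *
        p.basis m z) := by
    intro m
    induction m with
    | zero =>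
      rw [coef_succ hp]
      simp only [zero_add, Finset.sum_range_one, hop, basis_zero, hl, zpow_neg, zpow_natCast,
        zpow_sub_one₀ hQ, pow_zero, pow_one]
      field_simp
      ring
    | succ m ih =>
      have hm : p.Q ^ m ≠ 0 := pow_ne_zero m hQ
      rw [Finset.sum_range_succ, ih, coef_succ hp n (m + 1)]
      simp only [hop]
      rw [awOperator_basis hp hz h1 h2 h3]
      generalize (1 - p.a * p.b * p.Q ^ m) * (1 - p.a * p.c * p.Q ^ m) *
        (1 - p.a * p.d * p.Q ^ m) * (1 - p.Q ^ (m + 1)) = E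
      simp only [hl, zpow_neg, zpow_natCast, zpow_sub_one₀ hQ, pow_succ]
      generalize p.Q ^ m = t at *
      generalize p.Q ^ n = N at *
      field_simp
      ring
  have h := key n
  rw [coef_self_succ hp] at h
  simp only [zero_mul, mul_zero, neg_zero] at h
  simp only [mul_sub, Finset.sum_sub_distrib] at h
  rw [sub_eq_zero] at h
  rw [← Finset.sum_sub_distrib, ← Finset.sum_sub_distrib, Finset.mul_sum, Finset.mul_sum,
    Finset.mul_sum, ← Finset.sum_add_distrib]
  refine Eq.trans (Finset.sum_congr rfl fun k _ => ?_) (h.trans (Finset.sum_congr rfl fun k _ => ?_))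
  · ring
  · simp only [hop]; ring

/-! ### Distinct eigenvalues, orthogonality, monicity. -/

theorem eigenvalue_ne (hp : p.Admissible) {n m : ℕ} (h : n ≠ m) :
    ((p.Q ^ n)⁻¹ - 1) * (1 - p.abcd * p.Q ^ ((n : ℤ) - 1)) ≠
      ((p.Q ^ m)⁻¹ - 1) * (1 - p.abcd * p.Q ^ ((m : ℤ) - 1)) := by
  have hQ := hp.Q_ne_zero
  have hn : p.Q ^ n ≠ 0 := pow_ne_zero n hQ
  have hm : p.Q ^ m ≠ 0 := pow_ne_zero m hQ
  have h1 : p.Q ^ m - p.Q ^ n ≠ 0 := by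
    intro h0
    have h2 : p.q ^ m = p.q ^ n := by
      have := sub_eq_zero.1 h0
      simp only [Q] at this
      exact_mod_cast this
    exact h (pow_right_injective₀ hp.q_pos hp.q_lt_one.ne h2).symm
  -- The eigenvalues differ by (q^m - q^n)(1 - abcd q^{n+m-1})/q^{n+m}. As n ≠ m forces n + m ≥ 1,
  -- the truncated exponent is the true one.
  have h2 := hp.one_sub_abcd (n + m - 1)
  have h3 : p.Q ^ (n + m - 1) * p.Q = p.Q ^ n * p.Q ^ m := by
    rw [← pow_succ, ← pow_add]
    congr 1
    lia
  intro h0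
  refine mul_ne_zero (mul_ne_zero h1 h2) hQ ?_
  simp only [zpow_sub_one₀ hQ, zpow_natCast] at h0
  generalize p.Q ^ (n + m - 1) = t at *
  generalize p.Q ^ n = N at *
  generalize p.Q ^ m = M at *
  field_simp at h0
  linear_combination h0 + p.abcd * (N - M) * h3

theorem u_P_mul_P (hp : p.Admissible) {n m : ℕ} (h : n ≠ m) : p.u (p.P n * p.P m) = 0 :=
  u_mul_eq_zero_of_isEigen hp (isEigen_P hp n) (isEigen_P hp m) (eigenvalue_ne hp h)

theorem basisPoly_natDegree_le (i : ℕ) :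
    (1 - C (2 * p.a * p.Q ^ i) * X + C (p.a ^ 2 * p.Q ^ (2 * i)) : ℂ[X]).natDegree ≤ 1 := by
  compute_degree

theorem basisPoly_prod_natDegree_le (k : ℕ) :
    (∏ i ∈ Finset.range k, (1 - C (2 * p.a * p.Q ^ i) * X + C (p.a ^ 2 * p.Q ^ (2 * i)) :
      ℂ[X])).natDegree ≤ k := by
  refine (natDegree_prod_le _ _).trans ?_
  refine (Finset.sum_le_card_nsmul _ _ 1 fun i _ => basisPoly_natDegree_le i).trans ?_
  simp

theorem basisPoly_prod_coeff (k : ℕ) :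
    (∏ i ∈ Finset.range k, (1 - C (2 * p.a * p.Q ^ i) * X + C (p.a ^ 2 * p.Q ^ (2 * i)) :
      ℂ[X])).coeff k = ∏ i ∈ Finset.range k, -(2 * p.a * p.Q ^ i) := by
  have := coeff_prod_of_natDegree_le (Finset.range k)
    (fun i => (1 - C (2 * p.a * p.Q ^ i) * X + C (p.a ^ 2 * p.Q ^ (2 * i)) : ℂ[X])) 1
    fun i _ => basisPoly_natDegree_le i
  rw [Finset.card_range, mul_one] at this
  rw [this]
  refine Finset.prod_congr rfl fun i _ => ?_
  rw [coeff_add, coeff_sub, coeff_one, coeff_C_mul, coeff_X_one, coeff_C]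
  simp

theorem P_natDegree_le (n : ℕ) : (p.P n).natDegree ≤ n := by
  unfold P
  refine (natDegree_C_mul_le _ _).trans (natDegree_sum_le_of_forall_le _ _ fun k hk => ?_)
  exact (natDegree_C_mul_le _ _).trans
    ((basisPoly_prod_natDegree_le k).trans (Nat.lt_succ_iff.1 (Finset.mem_range.1 hk)))

/-- Only the term k = n reaches degree n; this evaluates the part of its leading coefficient that
`lead` has to normalize. -/
theorem qPoch_neg_self (hp : p.Admissible) (n : ℕ) :
    qPoch p.Q (p.Q ^ (-(n : ℤ))) n * (∏ i ∈ Finset.range n, -(2 * p.a * p.Q ^ i)) * p.Q ^ n =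
      (2 * p.a) ^ n * qPoch p.Q p.Q n := by
  have hQ := hp.Q_ne_zero
  have h : qPoch p.Q (p.Q ^ (-(n : ℤ))) n =
      ∏ i ∈ Finset.range n, (1 - (p.Q ^ (i + 1))⁻¹) := by
    rw [qPoch, ← Finset.prod_range_reflect]
    refine Finset.prod_congr rfl fun i hi => ?_
    have hi' := Finset.mem_range.1 hi
    rw [← zpow_natCast p.Q (n - 1 - i), ← zpow_add₀ hQ, ← zpow_natCast p.Q (i + 1), ← zpow_neg]
    congr 2
    lia
  have h2 : p.Q ^ n = ∏ i ∈ Finset.range n, p.Q := by simp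
  have h3 : (2 * p.a) ^ n = ∏ i ∈ Finset.range n, (2 * p.a) := by simp
  rw [h, h2, h3, qPoch, ← Finset.prod_mul_distrib, ← Finset.prod_mul_distrib,
    ← Finset.prod_mul_distrib]
  refine Finset.prod_congr rfl fun i _ => ?_
  have : p.Q ^ i ≠ 0 := pow_ne_zero i hQ
  rw [pow_succ]
  field_simp
  ring

theorem P_coeff_self (hp : p.Admissible) (n : ℕ) : (p.P n).coeff n = 1 := by
  have hQ := hp.norm_Q_lt.le
  have ha := hp.a_ne_zero
  have e1 := qPoch_ne_zero hQ (Admissible.norm_mul_lt hp.norm_a hp.norm_b) n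
  have e2 := qPoch_ne_zero hQ (Admissible.norm_mul_lt hp.norm_a hp.norm_c) n
  have e3 := qPoch_ne_zero hQ (Admissible.norm_mul_lt hp.norm_a hp.norm_d) n
  have e4 := qPoch_ne_zero hQ hp.norm_Q_lt n
  have e5 := hp.qPoch_abcd_ne_zero n
  have h := qPoch_neg_self hp n
  unfold P
  rw [coeff_C_mul, finsetSum_coeff, Finset.sum_range_succ, Finset.sum_eq_zero, zero_add,
    coeff_C_mul, basisPoly_prod_coeff, lead]
  · generalize qPoch p.Q (p.Q ^ (-(n : ℤ))) n = E at *
    generalize ∏ i ∈ Finset.range n, -(2 * p.a * p.Q ^ i) = F at *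
    generalize p.Q ^ n = N at *
    have ha2 : (2 * p.a) ^ n ≠ 0 := pow_ne_zero _ (mul_ne_zero two_ne_zero ha)
    generalize (2 * p.a) ^ n = G at *
    field_simp
    linear_combination h
  · intro k hk
    rw [coeff_C_mul, coeff_eq_zero_of_natDegree_lt, mul_zero]
    exact (basisPoly_prod_natDegree_le k).trans_lt (Finset.mem_range.1 hk)

theorem P_monic (hp : p.Admissible) (n : ℕ) : (p.P n).Monic :=
  monic_of_natDegree_le_of_coeff_eq_one n (P_natDegree_le n) (P_coeff_self hp n)

theorem P_natDegree (hp : p.Admissible) (n : ℕ) : (p.P n).natDegree = n :=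
  natDegree_eq_of_le_of_coeff_ne_zero (P_natDegree_le n) (by rw [P_coeff_self hp]; exact one_ne_zero)

/-! ### The lowering relation for P_{n-1}. -/

variable (p : Params)

/-- The factor `z (1/z - b)(1/z - c)(1/z - d)`. -/
noncomputable def cubic (z : ℂ) : ℂ := z * ((z⁻¹ - p.b) * (z⁻¹ - p.c) * (z⁻¹ - p.d))

/-- The product `(1 - bc q^m)(1 - bd q^m)(1 - cd q^m)`. -/
noncomputable def pairProd (m : ℕ) : ℂ :=
  (1 - p.b * p.c * p.Q ^ m) * (1 - p.b * p.d * p.Q ^ m) * (1 - p.c * p.d * p.Q ^ m)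

variable {p}

/-- For n = m + 1 the summand is, up to the factor -2ϰω_n, the k-th term of the discrepancy in the
lowering relation. The factor q^{-j} - q^{-(m+1)} kills the boundary term at j = m + 1. -/
theorem sum_lowering (hp : p.Admissible) {y : ℂ} (hy : y ≠ 0) (m j : ℕ) :
    ∑ k ∈ Finset.range (j + 1), (p.coef (m + 1) k *
        ((1 - p.Q ^ (m + 1)) * (1 - p.a * y) * ((p.Q ^ m)⁻¹ * y⁻¹ - p.b * p.c * p.d) +
          p.a * (p.Q ^ m)⁻¹ * p.pairProd m * (1 - p.Q ^ k) /
            (1 - p.abcd * p.Q ^ ((m : ℤ) - 1) * p.Q ^ k)) * p.basis k y +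
        p.a * p.cubic y * (p.coef (m + 1) k * p.basisDiff k y)) =
      p.coef (m + 1) j * p.basis j y * (1 - p.a * p.Q ^ j * y) *
        ((p.Q ^ j)⁻¹ - (p.Q ^ (m + 1))⁻¹) * (p.b * p.c * p.d * p.Q ^ (m + 1) - p.Q * y⁻¹) := by
  have hQ := hp.Q_ne_zero
  have hm : p.Q ^ m ≠ 0 := pow_ne_zero m hQ
  induction j with
  | zero =>
    -- At k = 0 the numerator 1 - q^k is zero, so the quotient is 0 even if its denominator 1 - abcd
    -- q^{m-1} vanishes.
    simp only [zero_add, Finset.sum_range_one, basisDiff, pow_zero, sub_self, mul_zero, zero_div,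
      add_zero, basis_zero, pow_succ]
    field_simp
    ring
  | succ j ih =>
    have hj : p.Q ^ j ≠ 0 := pow_ne_zero j hQ
    have hd := hp.one_sub_abcd (m + j)
    rw [pow_add, ← mul_assoc] at hd
    have hd' : p.abcd * p.Q ^ ((m : ℤ) - 1) * p.Q ^ (j + 1) = p.abcd * p.Q ^ m * p.Q ^ j := by
      rw [zpow_sub_one₀ hQ, zpow_natCast, pow_succ]
      field_simp
    have hc := coef_succ hp (m + 1) j
    have hz : p.Q ^ (-((m + 1 : ℕ) : ℤ)) = (p.Q ^ m * p.Q)⁻¹ := by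
      rw [zpow_neg, zpow_natCast, pow_succ]
    have hz' : p.Q ^ (((m + 1 : ℕ) : ℤ) - 1) = p.Q ^ m := by
      rw [← zpow_natCast]; congr 1; push_cast; ring
    rw [hz, hz'] at hc
    -- The previous boundary term is rewritten through the coefficient of index j + 1; the induction
    -- step becomes the rational identity `key`.
    have hc' : p.coef (m + 1) j * ((p.Q ^ j)⁻¹ - (p.Q ^ m * p.Q)⁻¹) =
        p.coef (m + 1) (j + 1) * ((1 - p.a * p.b * p.Q ^ j) * (1 - p.a * p.c * p.Q ^ j) *
          (1 - p.a * p.d * p.Q ^ j) * (1 - p.Q ^ j * p.Q)) /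
          (p.Q ^ j * p.Q * (1 - p.abcd * p.Q ^ m * p.Q ^ j)) := by
      rw [pow_succ p.Q j] at hc
      rw [hc]
      generalize 1 - p.abcd * p.Q ^ m * p.Q ^ j = Z at *
      field_simp
    rw [Finset.sum_range_succ, ih, hd', basisDiff, basis_succ]
    have e1 : p.coef (m + 1) j * p.basis j y * (1 - p.a * p.Q ^ j * y) *
        ((p.Q ^ j)⁻¹ - (p.Q ^ (m + 1))⁻¹) * (p.b * p.c * p.d * p.Q ^ (m + 1) - p.Q * y⁻¹) =
        (p.coef (m + 1) j * ((p.Q ^ j)⁻¹ - (p.Q ^ m * p.Q)⁻¹)) * (p.basis j y *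
          (1 - p.a * p.Q ^ j * y) * (p.b * p.c * p.d * p.Q ^ (m + 1) - p.Q * y⁻¹)) := by
      rw [pow_succ]; ring
    rw [e1, hc', pow_succ, pow_succ]
    unfold pairProd cubic
    generalize p.coef (m + 1) (j + 1) = c
    generalize p.basis j y = φ
    unfold abcd at *
    generalize p.Q ^ m = M at *
    generalize p.Q ^ j = t at *
    have key : (1 - M * p.Q) * (1 - p.a * y) * (M⁻¹ * y⁻¹ - p.b * p.c * p.d) *
          (1 - p.a * y⁻¹ * t) +
        p.a * M⁻¹ * ((1 - p.b * p.c * M) * (1 - p.b * p.d * M) * (1 - p.c * p.d * M)) *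
          (1 - t * p.Q) / (1 - p.a * p.b * p.c * p.d * M * t) * (1 - p.a * y⁻¹ * t) +
        p.a * (y * ((y⁻¹ - p.b) * (y⁻¹ - p.c) * (y⁻¹ - p.d))) * (1 - t * p.Q) +
        (1 - p.a * p.b * t) * (1 - p.a * p.c * t) * (1 - p.a * p.d * t) * (1 - t * p.Q) /
          (t * p.Q * (1 - p.a * p.b * p.c * p.d * M * t)) *
          (p.b * p.c * p.d * (M * p.Q) - p.Q * y⁻¹) =
        (1 - p.a * y⁻¹ * t) * (1 - p.a * (t * p.Q) * y) * ((t * p.Q)⁻¹ - (M * p.Q)⁻¹) *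
          (p.b * p.c * p.d * (M * p.Q) - p.Q * y⁻¹) := by
      clear * - hd hQ hm hj hy
      generalize hZ : 1 - p.a * p.b * p.c * p.d * M * t = Z at *
      field_simp
      subst hZ
      ring
    linear_combination (c * φ * (1 - p.a * t * y)) * key

theorem Q_half_sq (p : Params) : (p.Q ^ (1 / 2 : ℂ)) ^ 2 = p.Q := by
  rw [← Complex.cpow_nat_mul]; simp

theorem vk_eq (p : Params) :
    p.vk = p.Q ^ (1 / 2 : ℂ) - (p.Q ^ (1 / 2 : ℂ))⁻¹ := by
  rw [vk, Complex.cpow_neg]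

theorem half_mul_vk (hp : p.Admissible) : p.Q ^ (1 / 2 : ℂ) * p.vk = p.Q - 1 := by
  have h0 : p.Q ^ (1 / 2 : ℂ) ≠ 0 := by simp [hp.Q_ne_zero]
  rw [vk_eq p, mul_sub, mul_inv_cancel₀ h0, ← sq, Q_half_sq p]

theorem vk_ne_zero (hp : p.Admissible) : p.vk ≠ 0 := by
  intro h
  have := half_mul_vk hp
  rw [h, mul_zero] at this
  have h1 := hp.one_sub_Q_pow 0
  apply h1
  linear_combination this

theorem dx_eq (hp : p.Admissible) (s : ℂ) :
    p.dx s = (p.Q - 1) * (p.Q ^ s - (p.Q * p.Q ^ s)⁻¹) / 2 := by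
  have hQ := hp.Q_ne_zero
  have hy : p.Q ^ s ≠ 0 := by simp [hQ]
  rw [dx, x, x, Complex.cpow_neg, Complex.cpow_neg, Complex.cpow_add _ _ hQ, Complex.cpow_one]
  field_simp
  ring

/-- Φ(s) supplies the factor 1 - aq^s required by `basis_shift`, and the factor q^s - q^{-s-1} of
Δx(s) cancels against the one produced there. -/
theorem Xi_mul_shift (hp : p.Admissible) {s : ℂ} (hs : p.dx s ≠ 0) (n k : ℕ) :
    p.Xi s n * (p.basis k (p.Q * p.Q ^ s) - p.basis k (p.Q ^ s)) =
      2 * p.vk * p.pre n * (p.a * p.cubic (p.Q ^ s) * p.basisDiff k (p.Q ^ s)) := by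
  have hQ := hp.Q_ne_zero
  have hy : p.Q ^ s ≠ 0 := by simp [hQ]
  have hb := basis_shift hp hy k
  have hr := half_mul_vk hp
  rw [dx_eq hp] at hs
  have hq1 : p.Q - 1 ≠ 0 := fun h => hs (by rw [h]; simp)
  have hy1 : p.Q ^ s - (p.Q * p.Q ^ s)⁻¹ ≠ 0 := fun h => hs (by rw [h]; simp)
  have h2 : p.Q ^ (2 * s) = (p.Q ^ s) ^ 2 := by
    rw [two_mul, Complex.cpow_add _ _ hQ, sq]
  have hPhi : p.Phi s = -(p.Q - 1) * p.vk * p.cubic (p.Q ^ s) * (1 - p.a * p.Q ^ s) := by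
    rw [Phi, h2, Complex.cpow_neg p.Q s, ← hr, cubic]
    field_simp
  rw [Xi, hPhi, dx_eq hp]
  generalize p.basis k (p.Q * p.Q ^ s) - p.basis k (p.Q ^ s) = T at *
  generalize p.Q ^ s - (p.Q * p.Q ^ s)⁻¹ = Y at *
  generalize p.Q ^ s = y at *
  generalize p.Q - 1 = q1 at *
  field_simp
  linear_combination (p.pre n * p.vk * p.cubic y) * hb

/-- Adding Ξ removes Φ/Δx from Θ. What remains is arranged as a part free of s plus the s-dependent
part occurring in `sum_lowering`. -/
theorem Theta_add_Xi (hp : p.Admissible) (s : ℂ) (m : ℕ) :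
    p.Theta s (m + 1) + p.Xi s (m + 1) = 2 * p.vk * p.pre (m + 1) *
      (p.a * (p.Q ^ m)⁻¹ * (1 - p.Q ^ (m + 1)) * p.pairProd m / (1 - p.abcd * p.Q ^ (2 * m)) +
        (1 - p.Q ^ (m + 1)) * (1 - p.a * p.Q ^ s) *
          ((p.Q ^ m)⁻¹ * (p.Q ^ s)⁻¹ - p.b * p.c * p.d)) := by
  have hQ := hp.Q_ne_zero
  have hy : p.Q ^ s ≠ 0 := by simp [hQ]
  have hm : p.Q ^ m ≠ 0 := pow_ne_zero m hQ
  have ha := hp.a_ne_zero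
  have d0 := hp.one_sub_abcd (2 * m)
  have d1 := hp.one_sub_abcd (2 * m + 1)
  have d2 := hp.one_sub_abcd (2 * m + 2)
  have z1 : p.Q ^ (1 - ((m + 1 : ℕ) : ℤ)) = (p.Q ^ m)⁻¹ := by
    rw [← zpow_natCast, ← zpow_neg]; congr 1; push_cast; ring
  have z2 : p.Q ^ (2 * ((m + 1 : ℕ) : ℤ) - 1) = p.Q ^ (2 * m + 1) := by
    rw [← zpow_natCast]; congr 1; push_cast; ring
  have z3 : p.Q ^ (((m + 1 : ℕ) : ℤ) - 1) = p.Q ^ m := by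
    rw [← zpow_natCast]; congr 1; push_cast; ring
  have z4 : p.Q ^ (2 * ((m + 1 : ℕ) : ℤ) - 2) = p.Q ^ (2 * m) := by
    rw [← zpow_natCast]; congr 1; push_cast; ring
  have z5 : p.Q ^ (2 * (m + 1)) = p.Q ^ (2 * m + 2) := by congr 1
  have hh : p.Q ^ (((m + 1 : ℕ) : ℂ) / 2) ≠ 0 := by simp [hQ]
  have hh2 : (p.Q ^ (((m + 1 : ℕ) : ℂ) / 2)) ^ 2 = p.Q ^ m * p.Q := by
    rw [← Complex.cpow_nat_mul, ← pow_succ, ← Complex.cpow_natCast]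
    congr 1
    push_cast
    ring
  have hdx : p.dx (s - 1 / 2) = p.vk * (p.Q ^ s - (p.Q ^ s)⁻¹) / 2 := by
    have hr0 : p.Q ^ (1 / 2 : ℂ) ≠ 0 := by simp [hQ]
    rw [dx_eq hp, Complex.cpow_sub _ _ hQ, vk_eq p, ← Q_half_sq p]
    rw [Q_half_sq p]
    have := Q_half_sq p
    generalize p.Q ^ (1 / 2 : ℂ) = r at *
    generalize p.Q ^ s = y at *
    rw [← this]
    field_simp
  have hx1 : p.Q ^ (1 - ((m + 1 : ℕ) : ℂ) / 2) * p.x (s + ((m + 1 : ℕ) : ℂ) / 2) =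
      (p.Q * p.Q ^ s + (p.Q ^ m * p.Q ^ s)⁻¹) / 2 := by
    rw [Complex.cpow_sub _ _ hQ, x, Complex.cpow_neg, Complex.cpow_add _ _ hQ, Complex.cpow_one]
    generalize p.Q ^ (((m + 1 : ℕ) : ℂ) / 2) = h at *
    field_simp
    linear_combination -hh2
  have hx2 : p.Q ^ (1 - ((m + 1 : ℕ) : ℂ) / 2) * p.Q ^ (((m + 1 : ℕ) : ℂ) / 2) = p.Q := by
    rw [← Complex.cpow_add _ _ hQ]; simp
  have hxs : p.x s = (p.Q ^ s + (p.Q ^ s)⁻¹) / 2 := by rw [x, Complex.cpow_neg]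
  unfold Theta Xi
  rw [z1, z2, z3, z4, z5, hdx, hxs]
  unfold pairProd abcd at *
  have k1 : p.Q ^ (2 * m) = (p.Q ^ m) ^ 2 := by rw [mul_comm, pow_mul]
  have k2 : p.Q ^ (2 * m + 1) = (p.Q ^ m) ^ 2 * p.Q := by rw [pow_succ, k1]
  have k3 : p.Q ^ (2 * m + 2) = (p.Q ^ m) ^ 2 * p.Q ^ 2 := by rw [pow_add, k1]
  rw [k1] at d0 ⊢
  rw [k2] at d1 ⊢
  rw [k3] at d2 ⊢
  rw [pow_succ p.Q m]
  generalize p.Q ^ (1 - ((m + 1 : ℕ) : ℂ) / 2) = g at *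
  generalize p.Q ^ (((m + 1 : ℕ) : ℂ) / 2) = h at *
  generalize p.x (s + ((m + 1 : ℕ) : ℂ) / 2) = X at *
  generalize p.Phi s / p.dx s = F at *
  generalize p.pre (m + 1) = w at *
  generalize p.vk = v at *
  generalize p.Q ^ s = y at *
  generalize p.Q ^ m = M at *
  generalize p.Q = q at *
  generalize p.a = a at *
  generalize p.b = b at *
  generalize p.c = c at *
  generalize p.d = d at *
  -- With n = m + 1: `h1` cancels the pole at abcd q^{2n} = 1 between the two brackets, `h3` cancels
  -- the factor 1 - abcd q^{2n-1}, and `h4` is the remaining identity in y = q^s.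
  have h1 : M⁻¹ * (1 - a * b * c * d * (M ^ 2 * q)) * ((1 - a * b * c * d * M) *
        ((1 - a * b * (M * q)) * (1 - a * c * (M * q)) * (1 - a * d * (M * q))) /
        (a * (1 - a * b * c * d * (M ^ 2 * q)) * (1 - a * b * c * d * (M ^ 2 * q ^ 2)))) +
      (1 - a * b * c * d * M) / (1 - a * b * c * d * (M ^ 2 * q ^ 2)) * (q * (a + b + c + d -
        (a * b * c + a * b * d + a * c * d + b * c * d) * (M * q))) =
      (1 - a * b * c * d * M) * (1 + a ^ 2 * (M * q)) / (a * M) := by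
    clear * - d1 d2 ha hm
    generalize hZ : 1 - a * b * c * d * (M ^ 2 * q) = Z at *
    generalize hZ' : 1 - a * b * c * d * (M ^ 2 * q ^ 2) = Z' at *
    field_simp
    subst hZ'
    ring
  have h2 : (1 - a * b * c * d * M) / (1 - a * b * c * d * (M ^ 2 * q ^ 2)) *
      (1 - a * b * c * d * (M ^ 2 * q ^ 2)) = 1 - a * b * c * d * M := div_mul_cancel₀ _ d2
  have h3 : M⁻¹ * (1 - a * b * c * d * (M ^ 2 * q)) * (a * (1 - M * q) *
        ((1 - b * c * M) * (1 - b * d * M) * (1 - c * d * M)) /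
        ((1 - a * b * c * d * M ^ 2) * (1 - a * b * c * d * (M ^ 2 * q)))) =
      a * M⁻¹ * (1 - M * q) * ((1 - b * c * M) * (1 - b * d * M) * (1 - c * d * M)) /
        (1 - a * b * c * d * M ^ 2) := by
    generalize 1 - a * b * c * d * (M ^ 2 * q) = Z at *
    generalize 1 - a * b * c * d * M ^ 2 = Z' at *
    field_simp
  have h4 : M⁻¹ * (1 - a * b * c * d * (M ^ 2 * q)) * (2 * ((y + y⁻¹) / 2) - a - a⁻¹) +
      (1 - a * b * c * d * M) * (1 + a ^ 2 * (M * q)) / (a * M) -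
      (1 - a * b * c * d * M) * (q * y + (M * y)⁻¹) -
      M⁻¹ * (1 - M * q) * (1 - a * b * c * d * M) * (y - y⁻¹) =
      (1 - M * q) * (1 - a * y) * (M⁻¹ * y⁻¹ - b * c * d) := by
    field_simp
    ring
  generalize (1 - a * b * c * d * M) *
        ((1 - a * b * (M * q)) * (1 - a * c * (M * q)) * (1 - a * d * (M * q))) /
        (a * (1 - a * b * c * d * (M ^ 2 * q)) * (1 - a * b * c * d * (M ^ 2 * q ^ 2))) = S1 at *
  generalize a * (1 - M * q) *
        ((1 - b * c * M) * (1 - b * d * M) * (1 - c * d * M)) /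
        ((1 - a * b * c * d * M ^ 2) * (1 - a * b * c * d * (M ^ 2 * q))) = S2 at *
  generalize (1 - a * b * c * d * M) * (1 + a ^ 2 * (M * q)) / (a * M) = S3 at *
  generalize a * M⁻¹ * (1 - M * q) * ((1 - b * c * M) * (1 - b * d * M) * (1 - c * d * M)) /
        (1 - a * b * c * d * M ^ 2) = S4 at *
  rw [mul_div_assoc _ _ (1 - a * b * c * d * (M ^ 2 * q ^ 2))]
  generalize (1 - a * b * c * d * M) / (1 - a * b * c * d * (M ^ 2 * q ^ 2)) = S5 at *
  linear_combination (2 * v * w) * (h1 + h3 + h4) - 2 * v * w * (q * y + (M * y)⁻¹) * h2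
    - 4 * v * w * S5 * (1 - a * b * c * d * (M ^ 2 * q ^ 2)) * hx1 +
    2 * v * w * S5 * (a + b + c + d - (a * b * c + a * b * d + a * c * d + b * c * d) * (M * q)) *
      hx2

/-- Put D = abcd q^{m-1}. The claim is `coef_pred` combined with (1 - q^{m+1})(1 - Dq^k) - (1 -
q^k)(1 - Dq^{m+1}) = (q^k - q^{m+1})(1 - D); the factor 1 - D cancels the one in the denominator of
ω_n. -/
theorem coef_pred_eq (hp : p.Admissible) {m : ℕ} (hD : p.abcd * p.Q ^ ((m : ℤ) - 1) ≠ 1) (k : ℕ) :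
    p.coef m k = 2 * p.vk * p.pre (m + 1) * (p.coef (m + 1) k *
      (p.a * (p.Q ^ m)⁻¹ * (1 - p.Q ^ (m + 1)) * p.pairProd m / (1 - p.abcd * p.Q ^ (2 * m)) -
        p.a * (p.Q ^ m)⁻¹ * p.pairProd m * (1 - p.Q ^ k) /
            (1 - p.abcd * p.Q ^ ((m : ℤ) - 1) * p.Q ^ k))) := by
  have hQ := hp.Q_ne_zero
  have hm : p.Q ^ m ≠ 0 := pow_ne_zero m hQ
  have hv := vk_ne_zero hp
  have hab := hp.one_sub_ab m
  have hac := hp.one_sub_ac m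
  have had := hp.one_sub_ad m
  have hbc := hp.one_sub_bc m
  have hbd := hp.one_sub_bd m
  have hcd := hp.one_sub_cd m
  have d0 := hp.one_sub_abcd (2 * m)
  have hq1 := hp.one_sub_Q_pow m
  have dk : 1 - p.abcd * p.Q ^ ((m : ℤ) - 1) * p.Q ^ k ≠ 0 := by
    cases k with
    | zero => rw [pow_zero, mul_one]; exact sub_ne_zero.2 hD.symm
    | succ k =>
      have := hp.one_sub_abcd (m + k)
      rwa [zpow_sub_one₀ hQ, zpow_natCast, mul_assoc, mul_assoc, pow_succ', inv_mul_cancel_left₀ hQ,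
        ← pow_add]
  have dD : 1 - p.abcd * p.Q ^ ((m : ℤ) - 1) ≠ 0 := sub_ne_zero.2 hD.symm
  have h := coef_pred hp m k
  have z1 : p.Q ^ (((m + 1 : ℕ) : ℤ) - 1) = p.Q ^ m := by
    rw [← zpow_natCast]; congr 1; push_cast; ring
  have z2 : p.Q ^ (2 * ((m + 1 : ℕ) : ℤ) - 3) = p.Q ^ ((m : ℤ) - 1) * p.Q ^ m := by
    rw [← zpow_natCast, ← zpow_add₀ hQ]; congr 1; push_cast; ring
  have z3 : p.Q ^ (2 * ((m + 1 : ℕ) : ℤ) - 2) = p.Q ^ ((m : ℤ) - 1) * p.Q ^ m * p.Q := by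
    rw [← zpow_natCast, ← zpow_add₀ hQ, ← zpow_add_one₀ hQ]; congr 1; push_cast; ring
  have z4 : p.Q ^ (((m + 1 : ℕ) : ℤ) - 2) = p.Q ^ ((m : ℤ) - 1) := by
    congr 1; push_cast; ring
  have z5 : p.Q ^ (2 * m) = p.Q ^ ((m : ℤ) - 1) * p.Q ^ m * p.Q := by
    rw [← zpow_natCast, ← zpow_natCast, ← zpow_add₀ hQ, ← zpow_add_one₀ hQ]
    congr 1; push_cast; ring
  have z6 : p.Q ^ (-((m + 1 : ℕ) : ℤ)) = (p.Q ^ m * p.Q)⁻¹ := by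
    rw [zpow_neg, zpow_natCast, pow_succ]
  unfold pre pairProd
  rw [z1, z2, z3, z4]
  rw [z5] at d0 ⊢
  rw [z6] at h
  rw [pow_succ p.Q m] at h hq1 ⊢
  have hN : 1 - (p.Q ^ m * p.Q)⁻¹ = -(1 - p.Q ^ m * p.Q) / (p.Q ^ m * p.Q) := by
    field_simp
    ring
  rw [hN] at h
  generalize p.coef m k = c' at *
  generalize p.coef (m + 1) k = c at *
  generalize p.Q ^ ((m : ℤ) - 1) = e at *
  generalize p.Q ^ m = M at *
  generalize p.Q ^ k = K at *
  simp only [← mul_assoc] at h ⊢ d0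
  generalize hZ : 1 - p.abcd * e * M * p.Q = Z at *
  generalize 1 - p.abcd * e * M = Z1 at *
  generalize hZk : 1 - p.abcd * e * K = Zk at *
  generalize hZD : 1 - p.abcd * e = ZD at *
  generalize 1 - p.a * p.b * M = A1 at *
  generalize 1 - p.a * p.c * M = A2 at *
  generalize 1 - p.a * p.d * M = A3 at *
  generalize 1 - p.b * p.c * M = A4 at *
  generalize 1 - p.b * p.d * M = A5 at *
  generalize 1 - p.c * p.d * M = A6 at *
  have hk : (1 - M * p.Q) * Zk - (1 - K) * Z = (K - M * p.Q) * ZD := by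
    rw [← hZ, ← hZk, ← hZD]; ring
  clear * - hk h hQ hm hv hab hac had hbc hbd hcd d0 hq1 dk dD
  generalize hX : 1 - M * p.Q = X at *
  field_simp at h ⊢
  linear_combination (-ZD) * h - c * 2 * p.a * Z1 * Z * hk

theorem eval_x_eq_joukowski (hp : p.Admissible) (f : ℂ[X]) (s : ℂ) :
    f.eval (p.x s) = joukowski f (p.Q ^ s) ∧ f.eval (p.x (s + 1)) = joukowski f (p.Q * p.Q ^ s) := by
  refine ⟨by rw [joukowski, x, Complex.cpow_neg], ?_⟩
  rw [joukowski, x, Complex.cpow_neg, Complex.cpow_add _ _ hp.Q_ne_zero, Complex.cpow_one, mul_comm]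

/-- The lowering relation expressing `P_{n-1}` through `P_n(x(s))` and `P_n(x(s+1))`. -/
theorem eval_P_pred (hp : p.Admissible) {m : ℕ} (hD : p.abcd * p.Q ^ ((m : ℤ) - 1) ≠ 1)
    {s : ℂ} (hs : p.dx s ≠ 0) :
    (p.P m).eval (p.x s) = p.Theta s (m + 1) * (p.P (m + 1)).eval (p.x s) +
      p.Xi s (m + 1) * (p.P (m + 1)).eval (p.x (s + 1)) := by
  have hQ := hp.Q_ne_zero
  have hy : p.Q ^ s ≠ 0 := by simp [hQ]
  have hT := Theta_add_Xi hp s m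
  have hX := fun k => Xi_mul_shift hp hs (m + 1) k
  have hc := fun k => coef_pred_eq hp hD k
  have hS := sum_lowering hp hy m (m + 1)
  rw [sub_self, mul_zero, zero_mul] at hS
  rw [(eval_x_eq_joukowski hp _ s).1, (eval_x_eq_joukowski hp _ s).1,
    (eval_x_eq_joukowski hp _ s).2, joukowski_P hy, joukowski_P hy,
    joukowski_P (mul_ne_zero hQ hy)]
  have h0 : ∑ k ∈ Finset.range (m + 1), p.coef m k * p.basis k (p.Q ^ s) =
      ∑ k ∈ Finset.range (m + 1 + 1), p.coef m k * p.basis k (p.Q ^ s) := by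
    rw [Finset.sum_range_succ _ (m + 1), coef_self_succ hp, zero_mul, add_zero]
  rw [h0, Finset.mul_sum, Finset.mul_sum, ← Finset.sum_add_distrib, ← sub_eq_zero,
    ← Finset.sum_sub_distrib]
  -- The zero on the right is replaced by a multiple of the vanishing sum `hS`, so that the two
  -- sides can be compared term by term.
  rw [← mul_zero (-(2 * p.vk * p.pre (m + 1))), ← hS, Finset.mul_sum]
  refine Finset.sum_congr rfl fun k _ => ?_
  rw [hc k]
  linear_combination (-(p.coef (m + 1) k * p.basis k (p.Q ^ s))) * hT - p.coef (m + 1) k * hX k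

end Params

/-! ### Positivity of u and its consequences for P_n. -/

/-- The polynomial with conjugated coefficients. -/
noncomputable def conjPoly (f : ℂ[X]) : ℂ[X] := f.map (starRingEnd ℂ)

theorem conjPoly_mul (f g : ℂ[X]) : conjPoly (f * g) = conjPoly f * conjPoly g :=
  Polynomial.map_mul _

theorem conjPoly_conjPoly (f : ℂ[X]) : conjPoly (conjPoly f) = f := by
  ext n; simp [conjPoly]

theorem degree_conjPoly (f : ℂ[X]) : (conjPoly f).degree = f.degree :=
  degree_map_eq_of_injective (starRingEnd ℂ).injective f

theorem conjPoly_monic {f : ℂ[X]} (hf : f.Monic) : (conjPoly f).Monic := hf.map _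

theorem eval_conjPoly (f : ℂ[X]) (t : ℝ) :
    (conjPoly f).eval (t : ℂ) = starRingEnd ℂ (f.eval (t : ℂ)) := by
  have h := eval_map_apply (starRingEnd ℂ) (t : ℂ) (p := f)
  rwa [Complex.conj_ofReal] at h

namespace Params

variable {p : Params}

theorem continuous_integrand (hp : p.Admissible) (f : ℂ[X]) :
    Continuous fun θ : ℝ => f.eval (Real.cos θ : ℂ) * p.weight θ :=
  (f.continuous.comp (Complex.continuous_ofReal.comp Real.continuous_cos)).mul
    (continuous_weight hp)

/-- The functional `u` as a linear map. -/
noncomputable def uLin (hp : p.Admissible) : ℂ[X] →ₗ[ℂ] ℂ where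
  toFun := p.u
  map_add' f g := by
    simp only [u_eq_integral hp]
    rw [← intervalIntegral.integral_add ((continuous_integrand hp f).intervalIntegrable _ _)
      ((continuous_integrand hp g).intervalIntegrable _ _)]
    simp only [eval_add, add_mul]
  map_smul' c f := by
    simp only [u_eq_integral hp, eval_smul, smul_eq_mul, RingHom.id_apply, mul_assoc,
      intervalIntegral.integral_const_mul]

theorem uLin_apply (hp : p.Admissible) (f : ℂ[X]) : uLin hp f = p.u f := rfl

theorem uLin_C_mul (hp : p.Admissible) (c : ℂ) (f : ℂ[X]) :
    uLin hp (C c * f) = c * uLin hp f := by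
  rw [← smul_eq_C_mul, map_smul, smul_eq_mul]

theorem weight_pi (hp : p.Admissible) : p.weight Real.pi = 0 := by
  rw [weight, Complex.exp_pi_mul_I, halfWeight_neg_one hp]; simp

open scoped ComplexOrder in
-- The point θ = π is included because interval integrals run over (0, π].
theorem weight_eq_re (hp : p.Admissible) {θ : ℝ} (h0 : 0 < θ) (h1 : θ ≤ Real.pi) :
    p.weight θ = ((p.weight θ).re : ℂ) ∧ 0 ≤ (p.weight θ).re ∧
      (θ < Real.pi → 0 < (p.weight θ).re) := by
  rcases h1.lt_or_eq with h1 | rfl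
  · obtain ⟨h2, h3⟩ := Complex.pos_iff.1 (weight_pos hp h0 h1)
    refine ⟨Complex.ext (by simp) (by simp [← h3]), h2.le, fun _ => h2⟩
  · simp [weight_pi hp]

theorem exists_eval_cos_ne_zero {f : ℂ[X]} (hf : f ≠ 0) :
    ∃ θ : ℝ, 0 < θ ∧ θ < Real.pi ∧ f.eval (Real.cos θ : ℂ) ≠ 0 := by
  by_contra! h
  refine hf (eq_zero_of_infinite_isRoot f ?_)
  have hI : ((fun t : ℝ => (t : ℂ)) '' Set.Ioo (-1) 1).Infinite :=
    (Set.Ioo_infinite (by norm_num)).image Complex.ofReal_injective.injOn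
  refine hI.mono ?_
  rintro _ ⟨t, ⟨h0, h1⟩, rfl⟩
  have := h (Real.arccos t) (Real.arccos_pos.2 h1) (by
    rw [← Real.arccos_neg_one]
    exact Real.arccos_lt_arccos le_rfl h0 h1.le)
  rwa [Real.cos_arccos h0.le h1.le] at this

open scoped ComplexOrder in
/-- Positivity of `u`, with an extra factor that is positive on `(-1, 1)`. -/
theorem u_pos (hp : p.Admissible) {g : ℂ[X]} {γ : ℝ → ℝ}
    (hg : ∀ t : ℝ, g.eval (t : ℂ) = (γ t : ℂ)) (hγ : ∀ t ∈ Set.Ioo (-1 : ℝ) 1, 0 < γ t)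
    (hγ' : ∀ t ∈ Set.Icc (-1 : ℝ) 1, 0 ≤ γ t) {f : ℂ[X]} (hf : f ≠ 0) :
    0 < p.u (g * (f * conjPoly f)) := by
  set G : ℝ → ℝ := fun θ => ((g * (f * conjPoly f)).eval (Real.cos θ : ℂ) * p.weight θ).re with hG
  have hGc : Continuous G := Complex.continuous_re.comp (continuous_integrand hp _)
  have hval : ∀ θ : ℝ, 0 < θ → θ ≤ Real.pi →
      (g * (f * conjPoly f)).eval (Real.cos θ : ℂ) * p.weight θ =
        ((γ (Real.cos θ) * Complex.normSq (f.eval (Real.cos θ : ℂ)) * (p.weight θ).re : ℝ) : ℂ) := by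
    intro θ h0 h1
    rw [(weight_eq_re hp h0 h1).1, eval_mul, eval_mul, eval_conjPoly, Complex.mul_conj, hg]
    push_cast
    simp
  have hGv : ∀ θ : ℝ, 0 < θ → θ ≤ Real.pi →
      G θ = γ (Real.cos θ) * Complex.normSq (f.eval (Real.cos θ : ℂ)) * (p.weight θ).re := by
    intro θ h0 h1
    simp only [hG]
    rw [hval θ h0 h1, Complex.ofReal_re]
  have hu : p.u (g * (f * conjPoly f)) = ((∫ θ in (0 : ℝ)..Real.pi, G θ : ℝ) : ℂ) := by
    rw [u_eq_integral hp, ← intervalIntegral.integral_ofReal]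
    refine intervalIntegral.integral_congr_ae (.of_forall fun θ hθ => ?_)
    rw [Set.uIoc_of_le Real.pi_pos.le] at hθ
    rw [hval θ hθ.1 hθ.2, hGv θ hθ.1 hθ.2]
  rw [hu]
  have : 0 < ∫ θ in (0 : ℝ)..Real.pi, G θ := by
    obtain ⟨θ, h0, h1, h2⟩ := exists_eval_cos_ne_zero hf
    refine intervalIntegral.integral_pos Real.pi_pos hGc.continuousOn (fun τ hτ => ?_)
      ⟨θ, ⟨h0.le, h1.le⟩, ?_⟩
    · rw [hGv τ hτ.1 hτ.2]
      exact mul_nonneg (mul_nonneg (hγ' _ (Real.cos_mem_Icc τ)) (Complex.normSq_nonneg _))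
        (weight_eq_re hp hτ.1 hτ.2).2.1
    · rw [hGv θ h0 h1.le]
      refine mul_pos (mul_pos (hγ _ ⟨?_, ?_⟩) (Complex.normSq_pos.2 h2))
        ((weight_eq_re hp h0 h1.le).2.2 h1)
      · rw [← Real.cos_pi]
        exact Real.cos_lt_cos_of_nonneg_of_le_pi h0.le le_rfl h1
      · rw [← Real.cos_zero]
        exact Real.cos_lt_cos_of_nonneg_of_le_pi le_rfl h1.le h0
  exact_mod_cast this

theorem u_conjPoly (hp : p.Admissible) (f : ℂ[X]) :
    p.u (conjPoly f) = starRingEnd ℂ (p.u f) := by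
  rw [u_eq_integral hp, u_eq_integral hp, intervalIntegral.integral_of_le Real.pi_pos.le,
    intervalIntegral.integral_of_le Real.pi_pos.le, ← integral_conj]
  refine MeasureTheory.setIntegral_congr_fun measurableSet_Ioc fun θ hθ => ?_
  rw [eval_conjPoly, (weight_eq_re hp hθ.1 hθ.2).1]
  simp

open scoped ComplexOrder in
theorem u_mul_conj_pos (hp : p.Admissible) {f : ℂ[X]} (hf : f ≠ 0) :
    0 < p.u (f * conjPoly f) := by
  have := u_pos hp (g := 1) (γ := fun _ => 1) (by simp) (by simp) (by simp) hf
  rwa [one_mul] at this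

open scoped ComplexOrder in
theorem u_one_sub_mul_conj_pos (hp : p.Admissible) {f : ℂ[X]} (hf : f ≠ 0) :
    0 < p.u ((1 - X) * (f * conjPoly f)) :=
  u_pos hp (γ := fun t => 1 - t) (by simp) (fun t ht => sub_pos.2 ht.2)
    (fun t ht => sub_nonneg.2 ht.2) hf

open scoped ComplexOrder in
theorem u_one_add_mul_conj_pos (hp : p.Admissible) {f : ℂ[X]} (hf : f ≠ 0) :
    0 < p.u ((1 + X) * (f * conjPoly f)) :=
  u_pos hp (γ := fun t => 1 + t) (by simp) (fun t ht => by linarith [ht.1])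
    (fun t ht => by linarith [ht.1]) hf

theorem degree_C_mul_le' (c : ℂ) (f : ℂ[X]) : (C c * f).degree ≤ f.degree := by
  rw [← smul_eq_C_mul]; exact degree_smul_le c f

theorem P_degree (hp : p.Admissible) (n : ℕ) : (p.P n).degree = n := by
  rw [degree_eq_natDegree (P_monic hp n).ne_zero, P_natDegree hp]

/-- A polynomial orthogonal to `P_0, …, P_{n-1}` is orthogonal to all polynomials of degree less
than `n`. -/
theorem u_mul_eq_zero_of_degree_lt (hp : p.Admissible) {f : ℂ[X]} {n : ℕ}
    (hf : ∀ k < n, p.u (f * p.P k) = 0) :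
    ∀ g : ℂ[X], g.degree < n → p.u (f * g) = 0 := by
  induction n with
  | zero =>
    intro g hg
    have : g = 0 := by
      rw [← degree_eq_bot]
      exact Nat.WithBot.lt_zero_iff.1 (by simpa using hg)
    simp [this, ← uLin_apply hp]
  | succ n ih =>
    intro g hg
    have h1 : (g - C (g.coeff n) * p.P n).degree < n := by
      refine (degree_lt_iff_coeff_zero _ _).2 fun m hm => ?_
      rw [coeff_sub, coeff_C_mul]
      rcases hm.eq_or_lt with rfl | hm
      · rw [P_coeff_self hp, mul_one, sub_self]
      · rw [(degree_lt_iff_coeff_zero _ _).1 hg m hm, coeff_eq_zero_of_natDegree_lt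
          (p := p.P _) (by rwa [P_natDegree hp]), mul_zero, sub_zero]
    have h2 := ih (fun k hk => hf k (hk.trans n.lt_succ_self)) _ h1
    have h3 : f * g = f * (g - C (g.coeff n) * p.P n) + C (g.coeff n) * (f * p.P n) := by ring
    rw [h3, ← uLin_apply hp, map_add, uLin_C_mul, uLin_apply, uLin_apply, h2,
      hf n n.lt_succ_self, mul_zero, add_zero]

theorem u_P_mul_eq_zero (hp : p.Admissible) {n : ℕ} {g : ℂ[X]} (hg : g.degree < n) :
    p.u (p.P n * g) = 0 :=
  u_mul_eq_zero_of_degree_lt hp (fun _ hk => u_P_mul_P hp hk.ne') g hg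

open scoped ComplexOrder in
theorem eq_zero_of_orthogonal (hp : p.Admissible) {n : ℕ} {f : ℂ[X]} (hf : f.degree < n)
    (h : ∀ k < n, p.u (f * p.P k) = 0) : f = 0 := by
  by_contra h0
  have h1 := u_mul_eq_zero_of_degree_lt hp h (conjPoly f) (by rwa [degree_conjPoly])
  exact (u_mul_conj_pos hp h0).ne' h1

theorem degree_sub_lt_of_monic {f g : ℂ[X]} {n : ℕ} (hf : f.Monic) (hg : g.Monic)
    (hfn : f.natDegree = n) (hgn : g.natDegree = n) : (f - g).degree < n := by
  have hf' : f.degree = n := by rw [degree_eq_natDegree hf.ne_zero, hfn]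
  have hg' : g.degree = n := by rw [degree_eq_natDegree hg.ne_zero, hgn]
  rw [← hf']
  exact degree_sub_lt_left (hf'.trans hg'.symm) hf.ne_zero (by rw [hf.leadingCoeff, hg.leadingCoeff])

/-- Real coefficients are not visible in the ₄φ₃ when a is not real. They follow from uniqueness:
the conjugate is monic of the same degree and, u being real, orthogonal to the same lower P_k. -/
theorem conjPoly_P (hp : p.Admissible) (n : ℕ) : conjPoly (p.P n) = p.P n := by
  rw [← sub_eq_zero]
  refine eq_zero_of_orthogonal hp (n := n) (degree_sub_lt_of_monic (conjPoly_monic (P_monic hp n))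
    (P_monic hp n) ?_ (P_natDegree hp n)) fun k hk => ?_
  · rw [natDegree_eq_of_degree_eq (degree_conjPoly _), P_natDegree hp]
  · have h1 : p.u (conjPoly (p.P n) * p.P k) = 0 := by
      have h2 : p.u (p.P n * conjPoly (p.P k)) = 0 :=
        u_P_mul_eq_zero hp (by rw [degree_conjPoly, P_degree hp]; exact_mod_cast hk)
      have h3 := u_conjPoly hp (p.P n * conjPoly (p.P k))
      rwa [h2, map_zero, conjPoly_mul, conjPoly_conjPoly] at h3
    rw [sub_mul, ← uLin_apply hp, map_sub, uLin_apply, uLin_apply, h1, u_P_mul_P hp hk.ne', sub_zero]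

theorem eval_P_ofReal (hp : p.Admissible) (n : ℕ) (t : ℝ) :
    (p.P n).eval (t : ℂ) = (((p.P n).eval (t : ℂ)).re : ℂ) := by
  have := eval_conjPoly (p.P n) t
  rw [conjPoly_P hp] at this
  exact (Complex.conj_eq_iff_re.1 this.symm).symm

open scoped ComplexOrder in
theorem dSq_pos (hp : p.Admissible) (n : ℕ) : 0 < p.dSq n := by
  have := u_mul_conj_pos hp (P_monic hp n).ne_zero
  rwa [conjPoly_P hp, ← sq] at this

open scoped ComplexOrder in
theorem dSq_ne_zero (hp : p.Admissible) (n : ℕ) : p.dSq n ≠ 0 := (dSq_pos hp n).ne'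

theorem dSq_eq_re (hp : p.Admissible) (n : ℕ) :
    p.dSq n = ((p.dSq n).re : ℂ) ∧ 0 < (p.dSq n).re := by
  obtain ⟨h2, h3⟩ := Complex.pos_iff.1 (dSq_pos hp n)
  exact ⟨Complex.ext (by simp) (by simp [← h3]), h2⟩

theorem degree_lt_of_linear_mul {l g : ℂ[X]} {n : ℕ} (hl : l.degree = 1) (hg : (l * g).degree ≤ n) :
    g.degree < n := by
  by_cases h0 : g = 0
  · rw [h0, degree_zero]; exact WithBot.bot_lt_coe n
  · rw [degree_mul, hl, degree_eq_natDegree h0] at hg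
    rw [degree_eq_natDegree h0]
    have : 1 + g.natDegree ≤ n := by exact_mod_cast hg
    exact_mod_cast (by lia : g.natDegree < n)

open scoped ComplexOrder in
-- If P_n = (X - 1)g, then u(P_n ḡ) = -u((1 - X)g ḡ) < 0, against orthogonality since deg g < n.
theorem eval_one_P_ne_zero (hp : p.Admissible) (n : ℕ) : (p.P n).eval 1 ≠ 0 := by
  intro h
  obtain ⟨g, hg⟩ := dvd_iff_isRoot.2 h
  have hg0 : g ≠ 0 := fun h0 => (P_monic hp n).ne_zero (by rw [hg, h0, mul_zero])
  have hd : g.degree < n := degree_lt_of_linear_mul (degree_X_sub_C 1)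
    (by rw [← hg, P_degree hp])
  have h1 : p.u (p.P n * conjPoly g) = 0 := u_P_mul_eq_zero hp (by rwa [degree_conjPoly])
  have h2 := (u_one_sub_mul_conj_pos hp hg0).ne'
  apply h2
  have h3 : (1 - X) * (g * conjPoly g) = C (-1) * (p.P n * conjPoly g) := by
    rw [hg]; simp only [map_neg, map_one]; ring
  rw [h3, ← uLin_apply hp, uLin_C_mul, uLin_apply, h1, mul_zero]

open scoped ComplexOrder in
theorem eval_neg_one_P_ne_zero (hp : p.Admissible) (n : ℕ) : (p.P n).eval (-1) ≠ 0 := by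
  intro h
  obtain ⟨g, hg⟩ := dvd_iff_isRoot.2 h
  have hg0 : g ≠ 0 := fun h0 => (P_monic hp n).ne_zero (by rw [hg, h0, mul_zero])
  have hd : g.degree < n := degree_lt_of_linear_mul (degree_X_sub_C (-1))
    (by rw [← hg, P_degree hp])
  have h1 : p.u (p.P n * conjPoly g) = 0 := u_P_mul_eq_zero hp (by rwa [degree_conjPoly])
  have h2 := (u_one_add_mul_conj_pos hp hg0).ne'
  apply h2
  have h3 : (1 + X) * (g * conjPoly g) = p.P n * conjPoly g := by
    rw [hg]; simp only [map_neg, map_one]; ring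
  rw [h3, h1]

/-! ### The reproducing kernel and the Christoffel-Darboux formula. -/

variable (p) in
/-- The kernel `K_{n-1}(x, y)` as a polynomial in `x`. -/
noncomputable def kerPoly (n : ℕ) (y : ℂ) : ℂ[X] :=
  ∑ k ∈ Finset.range n, C ((p.P k).eval y / p.dSq k) * p.P k

theorem eval_kerPoly (n : ℕ) (y z : ℂ) : (p.kerPoly n y).eval z = p.kerPred n z y := by
  simp only [kerPoly, kerPred, eval_finsetSum, eval_mul, eval_C]
  exact Finset.sum_congr rfl fun k _ => by ring

theorem kerPred_comm (n : ℕ) (y z : ℂ) : p.kerPred n y z = p.kerPred n z y :=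
  Finset.sum_congr rfl fun k _ => by ring

theorem degree_sum_P_lt (hp : p.Admissible) (n : ℕ) (c : ℕ → ℂ) :
    (∑ k ∈ Finset.range n, C (c k) * p.P k).degree < n := by
  refine (degree_sum_le _ _).trans_lt ((Finset.sup_lt_iff (WithBot.bot_lt_coe n)).2 fun k hk => ?_)
  refine (degree_C_mul_le' _ _).trans_lt ?_
  rw [P_degree hp]
  exact Nat.cast_lt.2 (Finset.mem_range.1 hk)

theorem u_sum_mul_P (hp : p.Admissible) (n : ℕ) (c : ℕ → ℂ) {j : ℕ} (hj : j < n) :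
    p.u ((∑ k ∈ Finset.range n, C (c k) * p.P k) * p.P j) = c j * p.dSq j := by
  rw [Finset.sum_mul, ← uLin_apply hp, map_sum, Finset.sum_eq_single j]
  · rw [mul_assoc, uLin_C_mul, uLin_apply, ← sq, dSq]
  · intro k _ hk
    rw [mul_assoc, uLin_C_mul, uLin_apply, u_P_mul_P hp hk, mul_zero]
  · intro h
    exact absurd (Finset.mem_range.2 hj) h

/-- Expansion in the orthogonal basis. -/
theorem eq_sum_P (hp : p.Admissible) {n : ℕ} {f : ℂ[X]} (hf : f.degree < n) :
    f = ∑ k ∈ Finset.range n, C (p.u (f * p.P k) / p.dSq k) * p.P k := by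
  rw [← sub_eq_zero]
  refine eq_zero_of_orthogonal hp (n := n)
    ((degree_sub_le _ _).trans_lt (max_lt hf (degree_sum_P_lt hp n _))) fun k hk => ?_
  rw [sub_mul, ← uLin_apply hp, map_sub, uLin_apply, uLin_apply, u_sum_mul_P hp n _ hk,
    div_mul_cancel₀ _ (dSq_ne_zero hp k), sub_self]

/-- The reproducing property of the kernel. -/
theorem u_kerPoly_mul (hp : p.Admissible) {n : ℕ} {g : ℂ[X]} (hg : g.degree < n) (y : ℂ) :
    p.u (p.kerPoly n y * g) = g.eval y := by
  conv_rhs => rw [eq_sum_P hp hg]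
  rw [kerPoly, Finset.sum_mul, ← uLin_apply hp, map_sum, eval_finsetSum]
  refine Finset.sum_congr rfl fun k _ => ?_
  rw [mul_assoc, uLin_C_mul, uLin_apply, eval_mul, eval_C, mul_comm (p.P k) g]
  ring

/-- The Christoffel-Darboux formula. -/
theorem christoffel_darboux (hp : p.Admissible) (m : ℕ) {y : ℂ} (hy : (p.P m).eval y ≠ 0) :
    (X - C y) * p.kerPoly (m + 1) y =
      C (1 / p.dSq m) * (C ((p.P m).eval y) * p.P (m + 1) - C ((p.P (m + 1)).eval y) * p.P m) := by
  set F := C ((p.P m).eval y) * p.P (m + 1) - C ((p.P (m + 1)).eval y) * p.P m with hF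
  have hroot : F.IsRoot y := by
    rw [IsRoot, hF, eval_sub, eval_mul, eval_mul, eval_C, eval_C]
    ring
  obtain ⟨G, hG⟩ := dvd_iff_isRoot.2 hroot
  have hFdeg : F.degree ≤ (m + 1 : ℕ) := by
    refine (degree_sub_le _ _).trans (max_le ((degree_C_mul_le' _ _).trans ?_)
      ((degree_C_mul_le' _ _).trans ?_))
    · rw [P_degree hp]
    · rw [P_degree hp]; exact_mod_cast m.le_succ
  have hGdeg : G.degree < (m + 1 : ℕ) := degree_lt_of_linear_mul (degree_X_sub_C y) (by rwa [← hG])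
  have hGm : G.coeff m = (p.P m).eval y := by
    have h1 : F.coeff (m + 1) = (p.P m).eval y := by
      rw [hF, coeff_sub, coeff_C_mul, coeff_C_mul, P_coeff_self hp,
        coeff_eq_zero_of_natDegree_lt (by rw [P_natDegree hp]; exact m.lt_succ_self)]
      ring
    have h2 : G.coeff (m + 1) = 0 := (degree_lt_iff_coeff_zero _ _).1 hGdeg _ le_rfl
    rw [hG, sub_mul, coeff_sub, coeff_X_mul, coeff_C_mul, h2, mul_zero, sub_zero] at h1
    exact h1
  -- Write P_k = P_k(y) + (X - y)R. Then GP_k = P_k(y)G + FR, and F is orthogonal to R because deg R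
  -- < k ≤ m; no three-term recurrence is needed.
  have hGP : ∀ k < m + 1, p.u (G * p.P k) = (p.P k).eval y * p.u G := by
    intro k hk
    have hr : (p.P k - C ((p.P k).eval y)).IsRoot y := by simp
    obtain ⟨R, hR⟩ := dvd_iff_isRoot.2 hr
    have hRdeg : R.degree < k := degree_lt_of_linear_mul (degree_X_sub_C y) (by
      rw [← hR]
      refine (degree_sub_le _ _).trans (max_le (P_degree hp k).le (degree_C_le.trans ?_))
      exact_mod_cast k.zero_le)
    have h1 : p.u (p.P (m + 1) * R) = 0 :=
      u_P_mul_eq_zero hp (hRdeg.trans (by exact_mod_cast hk))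
    have h2 : p.u (p.P m * R) = 0 :=
      u_P_mul_eq_zero hp (hRdeg.trans_le (by exact_mod_cast Nat.lt_succ_iff.1 hk))
    have h3 : G * p.P k = C ((p.P k).eval y) * G + (C ((p.P m).eval y) * (p.P (m + 1) * R) -
        C ((p.P (m + 1)).eval y) * (p.P m * R)) := by
      have h4 : p.P k = C ((p.P k).eval y) + (X - C y) * R := by rw [← hR]; ring
      calc G * p.P k = G * (C ((p.P k).eval y) + (X - C y) * R) := by rw [← h4]
        _ = C ((p.P k).eval y) * G + ((X - C y) * G) * R := by ring
        _ = _ := by rw [← hG, hF]; ring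
    rw [h3, ← uLin_apply hp, map_add, map_sub, uLin_C_mul, uLin_C_mul, uLin_C_mul, uLin_apply,
      uLin_apply, uLin_apply, h1, h2]
    simp
  -- The leading coefficient P_m(y) of G gives u(GP_m) = P_m(y)d_m², while `hGP` gives P_m(y)u(G);
  -- `hy` permits the cancellation.
  have huG : p.u G = p.dSq m := by
    have h1 := hGP m m.lt_succ_self
    have h2 : (G - C ((p.P m).eval y) * p.P m).degree < m := by
      refine (degree_lt_iff_coeff_zero _ _).2 fun j hj => ?_
      rw [coeff_sub, coeff_C_mul]
      rcases hj.eq_or_lt with rfl | hj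
      · rw [P_coeff_self hp, mul_one, hGm, sub_self]
      · rw [(degree_lt_iff_coeff_zero _ _).1 hGdeg j hj, coeff_eq_zero_of_natDegree_lt
          (p := p.P _) (by rwa [P_natDegree hp]), mul_zero, sub_zero]
    have h3 := u_P_mul_eq_zero hp h2
    have h4 : G * p.P m = p.P m * (G - C ((p.P m).eval y) * p.P m) +
      C ((p.P m).eval y) * p.P m ^ 2 := by ring
    rw [h4, ← uLin_apply hp, map_add, uLin_C_mul, uLin_apply, uLin_apply, h3, zero_add] at h1
    exact (mul_left_cancel₀ hy h1).symm
  have hexp := eq_sum_P hp hGdeg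
  have hker : p.kerPoly (m + 1) y = C (1 / p.dSq m) * G := by
    rw [hexp, kerPoly, Finset.mul_sum]
    refine Finset.sum_congr rfl fun k hk => ?_
    rw [← mul_assoc, ← C_mul, hGP k (Finset.mem_range.1 hk), huG]
    congr 2
    have := dSq_ne_zero hp m
    field_simp
  rw [hker, hG]
  ring

/-! ### Adding point masses at ±1. -/

/-- Real data behind the kernel at the end points. -/
theorem exists_real_kernel (hp : p.Admissible) (n : ℕ) :
    ∃ v w K K' L : ℝ, (p.P n).eval (-1) = v ∧ (p.P n).eval 1 = w ∧ v ≠ 0 ∧ w ≠ 0 ∧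
      p.kerPred n (-1) (-1) = K ∧ p.kerPred n 1 1 = K' ∧ p.kerPred n (-1) 1 = L ∧
      0 ≤ K ∧ 0 ≤ K' ∧ L ^ 2 ≤ K * K' := by
  have h1 : ∀ k, (p.P k).eval 1 = (((p.P k).eval 1).re : ℂ) := fun k => by
    simpa using eval_P_ofReal hp k 1
  have h2 : ∀ k, (p.P k).eval (-1) = (((p.P k).eval (-1)).re : ℂ) := fun k => by
    simpa using eval_P_ofReal hp k (-1)
  have hd := fun k => dSq_eq_re hp k
  generalize hβ : (fun k => ((p.P k).eval 1).re) = β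
  generalize hα : (fun k => ((p.P k).eval (-1)).re) = α
  generalize hδ : (fun k => (p.dSq k).re) = δ
  replace h1 : ∀ k, (p.P k).eval 1 = (β k : ℂ) := fun k => by rw [← hβ]; exact h1 k
  replace h2 : ∀ k, (p.P k).eval (-1) = (α k : ℂ) := fun k => by rw [← hα]; exact h2 k
  replace hd : ∀ k, p.dSq k = (δ k : ℂ) ∧ 0 < δ k := fun k => by rw [← hδ]; exact hd k
  refine ⟨α n, β n, ∑ k ∈ Finset.range n, α k ^ 2 / δ k, ∑ k ∈ Finset.range n, β k ^ 2 / δ k,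
    ∑ k ∈ Finset.range n, α k * β k / δ k, h2 n, h1 n, ?_, ?_, ?_, ?_, ?_, ?_, ?_, ?_⟩
  · have := eval_neg_one_P_ne_zero hp n
    rw [h2] at this
    exact_mod_cast this
  · have := eval_one_P_ne_zero hp n
    rw [h1] at this
    exact_mod_cast this
  · simp only [kerPred, h2, (hd _).1, sq]
    push_cast
    rfl
  · simp only [kerPred, h1, (hd _).1, sq]
    push_cast
    rfl
  · simp only [kerPred, h1, h2, (hd _).1]
    push_cast
    rfl
  · exact Finset.sum_nonneg fun k _ => div_nonneg (sq_nonneg _) (hd k).2.le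
  · exact Finset.sum_nonneg fun k _ => div_nonneg (sq_nonneg _) (hd k).2.le
  -- Cauchy-Schwarz with the weights 1/d_k².
  · refine Finset.sum_sq_le_sum_mul_sum_of_sq_le_mul _
      (fun k _ => div_nonneg (sq_nonneg _) (hd k).2.le)
      (fun k _ => div_nonneg (sq_nonneg _) (hd k).2.le) fun k _ => le_of_eq ?_
    have := (hd k).2.ne'
    field_simp

theorem kappa_eq (A B : ℝ) (n : ℕ) : p.kappa A B n =
    (1 + A * p.kerPred n (-1) (-1)) * (1 + B * p.kerPred n 1 1) -
      A * B * p.kerPred n (-1) 1 ^ 2 := by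
  rw [kappa, Matrix.det_fin_two_of, kerPred_comm n 1 (-1)]
  ring

/-- κ = 1 + AK + BK' + AB(KK' - L²) ≥ 1. -/
theorem kappa_ne_zero (hp : p.Admissible) {A B : ℝ} (hA : 0 ≤ A) (hB : 0 ≤ B) (n : ℕ) :
    p.kappa A B n ≠ 0 := by
  obtain ⟨v, w, K, K', L, -, -, -, -, hK, hK', hL, h1, h2, h3⟩ := exists_real_kernel hp n
  rw [kappa_eq, hK, hK', hL]
  have : 0 < (1 + A * K) * (1 + B * K') - A * B * L ^ 2 := by
    nlinarith [mul_nonneg hA h1, mul_nonneg hB h2,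
      mul_le_mul_of_nonneg_left h3 (mul_nonneg hA hB)]
  exact_mod_cast this.ne'

/-- The form is Av² + Bw² + AB(K'v² - 2Lvw + Kw²). With v = P_n(-1) and w = P_n(1) it is κ_{n-1}
d_{n-1}² times the coefficient of X in `coeffB`. -/
theorem quadratic_form_pos {A B v w K K' L : ℝ} (hA : 0 ≤ A) (hB : 0 ≤ B) (hAB : 0 < A + B)
    (hv : v ≠ 0) (hw : w ≠ 0) (hK : 0 ≤ K) (hK' : 0 ≤ K') (hL : L ^ 2 ≤ K * K') :
    0 < A * ((1 + B * K') * v - B * L * w) * v + B * ((1 + A * K) * w - A * L * v) * w := by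
  have hq : 0 ≤ K' * v ^ 2 - 2 * L * v * w + K * w ^ 2 := by
    rcases hK.eq_or_lt with h | h
    · rw [← h, zero_mul] at hL
      have : L = 0 := pow_eq_zero_iff two_ne_zero |>.1 (le_antisymm hL (sq_nonneg L))
      rw [this, ← h]
      have := mul_nonneg hK' (sq_nonneg v)
      linarith
    -- K times the form is (Kw - Lv)² + (KK' - L²)v².
    · have h1 : 0 ≤ K * (K' * v ^ 2 - 2 * L * v * w + K * w ^ 2) := by
        nlinarith [sq_nonneg (K * w - L * v), mul_le_mul_of_nonneg_right hL (sq_nonneg v)]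
      exact nonneg_of_mul_nonneg_right h1 h
  have h1 : 0 < A * v ^ 2 + B * w ^ 2 := by
    rcases hA.eq_or_lt with h | h
    · have hB' : 0 < B := by linarith
      have := mul_nonneg hA (sq_nonneg v)
      have := mul_pos hB' (sq_pos_of_ne_zero hw)
      linarith
    · have := mul_pos h (sq_pos_of_ne_zero hv)
      have := mul_nonneg hB (sq_nonneg w)
      linarith
  nlinarith [mul_nonneg (mul_nonneg hA hB) hq]

/-- A generalized Askey-Wilson polynomial in terms of the kernel. -/
theorem IsGenAW.eq_sub (hp : p.Admissible) {A B : ℝ} {n : ℕ} {f : ℂ[X]} (hf : p.IsGenAW A B n f) :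
    f = p.P n - C (A * f.eval (-1)) * p.kerPoly n (-1) - C (B * f.eval 1) * p.kerPoly n 1 := by
  have hd : (f - p.P n).degree < n :=
    degree_sub_lt_of_monic hf.monic (P_monic hp n) hf.natDegree_eq (P_natDegree hp n)
  have h := eq_sum_P hp hd
  have h1 : ∑ k ∈ Finset.range n, C (p.u ((f - p.P n) * p.P k) / p.dSq k) * p.P k =
      -(C (A * f.eval (-1)) * p.kerPoly n (-1) + C (B * f.eval 1) * p.kerPoly n 1) := by
    rw [kerPoly, kerPoly, Finset.mul_sum, Finset.mul_sum, ← Finset.sum_add_distrib,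
      ← Finset.sum_neg_distrib]
    refine Finset.sum_congr rfl fun k hk => ?_
    have hk' := Finset.mem_range.1 hk
    have h2 := hf.orthogonal (p.P k) (by rw [P_degree hp]; exact_mod_cast hk')
    rw [uMod, eval_mul, eval_mul] at h2
    have h3 : p.u ((f - p.P n) * p.P k) =
        -(A * f.eval (-1) * (p.P k).eval (-1) + B * f.eval 1 * (p.P k).eval 1) := by
      rw [sub_mul, ← uLin_apply hp, map_sub, uLin_apply, uLin_apply, u_P_mul_P hp hk'.ne']
      linear_combination h2
    rw [h3, ← mul_assoc, ← mul_assoc, ← C_mul, ← C_mul, ← add_mul, ← C_add, ← neg_mul, ← C_neg]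
    congr 2
    ring
  rw [sub_sub, sub_eq_add_neg, ← h1, ← h]
  ring

/-- Cramer's rule for the linear system obtained by evaluating `IsGenAW.eq_sub` at ±1; its
determinant is κ_{n-1}. -/
theorem IsGenAW.eval_eq (hp : p.Admissible) {A B : ℝ} (hA : 0 ≤ A) (hB : 0 ≤ B) {n : ℕ} {f : ℂ[X]}
    (hf : p.IsGenAW A B n f) :
    f.eval (-1) = ((1 + B * p.kerPred n 1 1) * (p.P n).eval (-1) -
        B * p.kerPred n (-1) 1 * (p.P n).eval 1) / p.kappa A B n ∧
      f.eval 1 = ((1 + A * p.kerPred n (-1) (-1)) * (p.P n).eval 1 -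
        A * p.kerPred n 1 (-1) * (p.P n).eval (-1)) / p.kappa A B n := by
  have h := hf.eq_sub hp
  have hk := kappa_ne_zero hp hA hB n
  have e1 := congrArg (eval (-1)) h
  have e2 := congrArg (eval 1) h
  simp only [eval_sub, eval_mul, eval_C, eval_kerPoly] at e1 e2
  rw [kerPred_comm n 1 (-1)] at *
  rw [eq_div_iff hk, eq_div_iff hk, kappa_eq]
  constructor
  · linear_combination (1 + B * p.kerPred n 1 1) * e1 - B * p.kerPred n (-1) 1 * e2
  · linear_combination (1 + A * p.kerPred n (-1) (-1)) * e2 - A * p.kerPred n (-1) 1 * e1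

/-- For existence, the Cramer values e, e' are put into the kernel formula; `hfe` and `hfe'` check
that they are the actual end-point values, and the reproducing property makes the kernel terms
cancel the masses. Uniqueness holds because the kernel formula determines f. -/
theorem existsUnique_isGenAW (hp : p.Admissible) {A B : ℝ} (hA : 0 ≤ A) (hB : 0 ≤ B) (n : ℕ) :
    ∃! f : ℂ[X], p.IsGenAW A B n f := by
  have hk := kappa_ne_zero hp hA hB n
  set e := ((1 + B * p.kerPred n 1 1) * (p.P n).eval (-1) -
        B * p.kerPred n (-1) 1 * (p.P n).eval 1) / p.kappa A B n with he
  set e' := ((1 + A * p.kerPred n (-1) (-1)) * (p.P n).eval 1 -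
        A * p.kerPred n 1 (-1) * (p.P n).eval (-1)) / p.kappa A B n with he'
  set f := p.P n - (C (A * e) * p.kerPoly n (-1) + C (B * e') * p.kerPoly n 1) with hf
  have h1 : e * p.kappa A B n = _ := div_mul_cancel₀ _ hk
  have h2 : e' * p.kappa A B n = _ := div_mul_cancel₀ _ hk
  have hκ := kappa_eq (p := p) A B n
  rw [kerPred_comm n 1 (-1)] at h2
  have hfe : f.eval (-1) = e := by
    rw [hf, eval_sub, eval_add, eval_mul, eval_mul, eval_C, eval_C, eval_kerPoly, eval_kerPoly]
    apply mul_right_cancel₀ hk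
    linear_combination (-(A * p.kerPred n (-1) (-1)) - 1) * h1 - B * p.kerPred n (-1) 1 * h2 +
      (p.P n).eval (-1) * hκ
  have hfe' : f.eval 1 = e' := by
    rw [hf, eval_sub, eval_add, eval_mul, eval_mul, eval_C, eval_C, eval_kerPoly, eval_kerPoly,
      kerPred_comm n 1 (-1)]
    apply mul_right_cancel₀ hk
    linear_combination (-(B * p.kerPred n 1 1) - 1) * h2 - A * p.kerPred n (-1) 1 * h1 +
      (p.P n).eval 1 * hκ
  have hdeg : (C (A * e) * p.kerPoly n (-1) + C (B * e') * p.kerPoly n 1).degree < n :=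
    (degree_add_le _ _).trans_lt (max_lt
      ((degree_C_mul_le' _ _).trans_lt (degree_sum_P_lt hp n _))
      ((degree_C_mul_le' _ _).trans_lt (degree_sum_P_lt hp n _)))
  refine ⟨f, ⟨?_, ?_, fun g hg => ?_⟩, fun g hg => ?_⟩
  · exact (P_monic hp n).sub_of_left (by rwa [P_degree hp])
  · rw [hf, natDegree_eq_of_degree_eq (degree_sub_eq_left_of_degree_lt (by rwa [P_degree hp])),
      P_natDegree hp]
  · rw [uMod, eval_mul, eval_mul, hfe, hfe']
    have h1 : f * g = p.P n * g - (C (A * e) * (p.kerPoly n (-1) * g) +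
      C (B * e') * (p.kerPoly n 1 * g)) := by rw [hf]; ring
    rw [h1, ← uLin_apply hp, map_sub, map_add, uLin_C_mul, uLin_C_mul, uLin_apply, uLin_apply,
      uLin_apply, u_P_mul_eq_zero hp hg, u_kerPoly_mul hp hg, u_kerPoly_mul hp hg]
    ring
  · obtain ⟨h1, h2⟩ := IsGenAW.eval_eq hp hA hB hg
    rw [IsGenAW.eq_sub hp hg, h1, h2, sub_sub]

theorem coeffA_natDegree (A B : ℝ) (n : ℕ) (f : ℂ[X]) : (p.coeffA A B n f).natDegree = 2 := by
  have h : ∀ x y z : ℂ, ((X ^ 2 - 1) - C x * (C y * (X - 1) + C z * (X + 1)) : ℂ[X]) =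
      C 1 * X ^ 2 + C (-(x * (y + z))) * X + C (x * (y - z) - 1) := fun x y z => by
    simp only [map_neg, map_mul, map_add, map_sub, map_one]
    ring
  rw [coeffA, h, natDegree_quadratic one_ne_zero]

theorem IsGenAW.coeffB_natDegree (hp : p.Admissible) {A B : ℝ} (hA : 0 ≤ A) (hB : 0 ≤ B)
    (hAB : 0 < A + B) {n : ℕ} {f : ℂ[X]} (hf : p.IsGenAW A B n f) :
    (p.coeffB A B n f).natDegree = 1 := by
  have hk := kappa_ne_zero hp hA hB n
  obtain ⟨h1, h2⟩ := hf.eval_eq hp hA hB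
  obtain ⟨v, w, K, K', L, hv, hw, hv0, hw0, hK, hK', hL, k1, k2, k3⟩ := exists_real_kernel hp n
  have hq := quadratic_form_pos hA hB hAB hv0 hw0 k1 k2 k3
  have hne : A * f.eval (-1) * (p.P n).eval (-1) + B * f.eval 1 * (p.P n).eval 1 ≠ 0 := by
    rw [h1, h2, kerPred_comm n 1 (-1), hv, hw, hK, hK', hL]
    intro h0
    have h3 : (A * ((1 + B * K') * v - B * L * w) * v + B * ((1 + A * K) * w - A * L * v) * w : ℂ) =
        0 := by
      have := congrArg (· * p.kappa A B n) h0
      simp only [zero_mul] at this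
      rw [← this]
      field_simp
    exact hq.ne' (by exact_mod_cast h3)
  have hd := one_div_ne_zero (dSq_ne_zero hp (n - 1))
  have hform : p.coeffB A B n f = C (1 / p.dSq (n - 1) * (A * f.eval (-1) * (p.P n).eval (-1) +
      B * f.eval 1 * (p.P n).eval 1)) * X + C (1 / p.dSq (n - 1) *
      (B * f.eval 1 * (p.P n).eval 1 - A * f.eval (-1) * (p.P n).eval (-1))) := by
    unfold coeffB
    simp only [C_mul, C_add, C_sub]
    ring
  rw [hform, natDegree_linear (mul_ne_zero hd hne)]

/-- In (X - 1)(X + 1) times `IsGenAW.eq_sub`, Christoffel-Darboux absorbs X - 1 into the kernel at 1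
and X + 1 into the kernel at -1; the other linear factor stays in the coefficient. -/
theorem IsGenAW.connection (hp : p.Admissible) {A B : ℝ} {m : ℕ} {f : ℂ[X]}
    (hf : p.IsGenAW A B (m + 1) f) :
    (X ^ 2 - 1) * f = p.coeffA A B (m + 1) f * p.P (m + 1) + p.coeffB A B (m + 1) f * p.P m := by
  have h1 := christoffel_darboux hp m (eval_one_P_ne_zero hp m)
  have h2 := christoffel_darboux hp m (eval_neg_one_P_ne_zero hp m)
  have h := hf.eq_sub hp
  rw [coeffA, coeffB, Nat.add_sub_cancel]
  conv_lhs => rw [h]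
  simp only [map_neg, map_one, C_mul] at h1 h2 ⊢
  linear_combination (-(C (B : ℂ) * C (f.eval 1) * (X + 1))) * h1 -
    C (A : ℂ) * C (f.eval (-1)) * (X - 1) * h2

end Params

end AskeyWilson

theorem mainTheorem2 (p : AskeyWilson.Params) (hp : p.Admissible)
    (A B : ℝ) (hA : 0 ≤ A) (hB : 0 ≤ B) (hAB : 0 < A + B) (n : ℕ) (hn : 1 ≤ n) :
    (∀ k, p.dSq k ≠ 0) ∧ p.kappa A B n ≠ 0 ∧
    (∃! f : ℂ[X], p.IsGenAW A B n f) ∧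
    ∀ Pt : ℂ[X], p.IsGenAW A B n Pt →
      (Pt.eval (-1) =
          ((1 + B * p.kerPred n 1 1) * (p.P n).eval (-1) - B * p.kerPred n (-1) 1 * (p.P n).eval 1) /
            p.kappa A B n ∧
        Pt.eval 1 =
          ((1 + A * p.kerPred n (-1) (-1)) * (p.P n).eval 1 -
              A * p.kerPred n 1 (-1) * (p.P n).eval (-1)) /
            p.kappa A B n) ∧
      ((p.coeffA A B n Pt).natDegree = 2 ∧ (p.coeffB A B n Pt).natDegree = 1) ∧
      (∀ s : ℂ,
        (p.x s ^ 2 - 1) * Pt.eval (p.x s) =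
          (p.coeffA A B n Pt).eval (p.x s) * (p.P n).eval (p.x s) +
            (p.coeffB A B n Pt).eval (p.x s) * (p.P (n - 1)).eval (p.x s)) ∧
      (p.abcd * p.Q ^ ((n : ℤ) - 2) ≠ 1 → ∀ s : ℂ, p.dx s ≠ 0 →
        (p.P (n - 1)).eval (p.x s) =
            p.Theta s n * (p.P n).eval (p.x s) + p.Xi s n * (p.P n).eval (p.x (s + 1)) ∧
        (p.x s ^ 2 - 1) * Pt.eval (p.x s) =
          ((p.coeffA A B n Pt).eval (p.x s) +
              (p.coeffB A B n Pt).eval (p.x s) * p.Theta s n) * (p.P n).eval (p.x s) +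
            ((p.coeffB A B n Pt).eval (p.x s) * p.Xi s n) * (p.P n).eval (p.x (s + 1))) := by
  obtain ⟨m, rfl⟩ : ∃ m, n = m + 1 := ⟨n - 1, by lia⟩
  refine ⟨AskeyWilson.Params.dSq_ne_zero hp, AskeyWilson.Params.kappa_ne_zero hp hA hB _,
    AskeyWilson.Params.existsUnique_isGenAW hp hA hB _, fun f hf => ?_⟩
  have hconn : ∀ s : ℂ, (p.x s ^ 2 - 1) * f.eval (p.x s) =
      (p.coeffA A B (m + 1) f).eval (p.x s) * (p.P (m + 1)).eval (p.x s) +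
        (p.coeffB A B (m + 1) f).eval (p.x s) * (p.P m).eval (p.x s) := fun s => by
    have h := congrArg (eval (p.x s)) (AskeyWilson.Params.IsGenAW.connection hp hf)
    simpa only [eval_mul, eval_sub, eval_add, eval_pow, eval_X, eval_one] using h
  refine ⟨AskeyWilson.Params.IsGenAW.eval_eq hp hA hB hf,
    ⟨AskeyWilson.Params.coeffA_natDegree A B _ f,
      AskeyWilson.Params.IsGenAW.coeffB_natDegree hp hA hB hAB hf⟩, hconn, fun hD s hs => ?_⟩
  have hD' : p.abcd * p.Q ^ ((m : ℤ) - 1) ≠ 1 := by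
    have h : ((m + 1 : ℕ) : ℤ) - 2 = (m : ℤ) - 1 := by push_cast; ring
    rwa [h] at hD
  have h := AskeyWilson.Params.eval_P_pred hp hD' hs
  refine ⟨h, ?_⟩
  rw [hconn s, h]
  ring
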